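/- Let $R$ be a commutative ring. An $A_\infty$-category $\mathscr A$ over $R$ (small, not necessarily flat) consists of a set of objects, $\mathbb Z$-graded $R$-modules $\mathscr A(x,y)$ and, for all $n\ge 0$, $R$-multilinear operations $m^n:\mathscr A(x_{n-1},x_n)\otimes\dots\otimes\mathscr A(x_0,x_1)\to\mathscr A(x_0,x_n)$ of degree $2-n$ such that, for all $n\ge0$ and homogeneous $f_i\in\mathscr A(x_{i-1},x_i)$, $$\sum_{d,m\ge 0,\ d+m\le n}(-1)^{\dagger_d}\,m^{n-m+1}(f_n,\dots,f_{d+m+1},m^m(f_{d+m},\dots,f_{d+1}),f_d,\dots,f_1)=0,\qquad \dagger_d=\deg f_d+\dots+\deg f_1-d .$$ An $A_\infty$-functor $\mathscr F:\mathscr A\to\mathscr B$ consists of a map $\mathscr F^0$ of objects and multilinear maps $\mathscr F^n$, $n\ge1$, of degree $1-n$ such that, for all $n\ge 0$, $$\sum m_{\mathscr B}^r(\mathscr F^{i_r}(f_n,\dots),\dots,\mathscr F^{i_1}(f_{i_1},\dots,f_1))=\sum(-1)^{\dagger_d}\mathscr F^{n-m+1}(f_n,\dots,f_{d+m+1},m_{\mathscr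 A}^m(f_{d+m},\dots,f_{d+1}),f_d,\dots,f_1),$$ the left sum being over all $i_r+\dots+i_1=n$ with $i_j\ge1$; composition is $(\mathscr G\cdot\mathscr F)^n(f_n,\dots,f_1)=\sum_{i_r+\dots+i_1=n}\mathscr G^r(\mathscr F^{i_r}(f_n,\dots),\dots,\mathscr F^{i_1}(f_{i_1},\dots,f_1))$. $\mathscr A$ is strictly unital if each object $x$ has a (necessarily unique) $1_x\in\mathscr A(x,x)$ such that $m^n(\dots,1_x,\dots)=0$ for $n\neq 2$ and $m^2(f,1_x)=f$, $m^2(1_y,f)=(-1)^{\deg f}f$ for homogeneous $f\in\mathscr A(x,y)$. An $A_\infty$-functor between strictly unital $A_\infty$-categories is strictly unital if $\mathscr F^1(1_x)=1_{\mathscr F^0(x)}$ and $\mathscr F^n(\dots,1_x,\dots)=0$ for $n\ge2$. An $A_\infty$-functor $\mathscr F:\mathscr A\to\mathscr B$ satisfies (F1) if for all objects $x,y$ the map $\mathscr F^1:\mathscr A(x,y)\to\mathscr B(\mathscr F^0(x),\mathscr F^0(y))$ is a split surjection of graded $R$-modules. **Corollary.** Let $\mathscr A,\mathscr A',\mathscr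 A''$ be strictly unital $A_\infty$-categories, let $\mathscr F:\mathscr A\to\mathscr A'$ be a strictly unital $A_\infty$-functor satisfying (F1), and let $\mathscr G:\mathscr A''\to\mathscr A'$ be a strictly unital $A_\infty$-functor. Then the diagram $\mathscr A\xrightarrow{\mathscr F}\mathscr A'\xleftarrow{\mathscr G}\mathscr A''$ has a pullback $(\mathscr P,\ \alpha:\mathscr P\to\mathscr A'',\ \beta:\mathscr P\to\mathscr A)$ in the category of strictly unital $A_\infty$-categories and strictly unital $A_\infty$-functors; in particular $\alpha$ and $\beta$ are strictly unital. It can be chosen so that, via $(\beta^0,\alpha^0)$, the objects of $\mathscr P$ are the pairs $(x,y)$ with $\mathscr F^0(x)=\mathscr G^0(y)$; via $(\beta^1,\alpha^1)$, the morphisms $(x_1,y_1)\to(x_2,y_2)$ are the pairs $(a,a'')\in\mathscr A(x_1,x_2)\times\mathscr A''(y_1,y_2)$ with $\mathscr F^1(a)=\mathscr G^1(a'')$; the unit of $(x,y)$ is $(1_x,1_y)$; and $\alpha$ satisfies (F1). -/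

import Mathlib

universe w u v

namespace AInf

/-! ### Composable strings -/

/-- `Str H x y`: composable strings `(fₙ, …, f₁)` with `n ≥ 0`, `f₁` starting at `x` and `fₙ` ending
at `y`, where `H y z` is the set of morphisms from `y` to `z`.
The head of the string is `fₙ`, the last morphism. -/
inductive Str {O : Type u} (H : O → O → Type v) (x : O) : O → Type (max u v)
  | nil : Str H x x
  | cons {y z : O} (f : H y z) (p : Str H x y) : Str H x z

namespace Str

variable {O : Type u} {H : O → O → Type v}

/-- The number `n` of morphisms in `(fₙ, …, f₁)`. -/
def length {x : O} : {y : O} → Str H x y → ℕ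
  | _, nil => 0
  | _, cons _ p => p.length + 1

/-- The string `(f)` of length one. -/
def single {x y : O} (f : H x y) : Str H x y := cons f nil

/-- Concatenation `(gₘ, …, g₁, fₙ, …, f₁)` of `(gₘ, …, g₁)` and `(fₙ, …, f₁)`. -/
def append {x y : O} : {z : O} → Str H y z → Str H x y → Str H x z
  | _, nil, q => q
  | _, cons f p, q => cons f (p.append q)

/-- Apply a map of objects `o` and a map of morphisms `φ` to each entry of a string. -/
def map {O' : Type*} {H' : O' → O' → Type*} (o : O → O')
    (φ : ∀ {x y : O}, H x y → H' (o x) (o y)) {x : O} :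
    {y : O} → Str H x y → Str H' (o x) (o y)
  | _, nil => nil
  | _, cons f p => cons (φ f) (p.map o φ)

/-- All the ways of writing a string as a concatenation `a.append b` of two (possibly empty)
strings `a`, `b`; the entry is `⟨y, a, b⟩`, where `y` is the object at which the string is cut. -/
def splits {x : O} : {z : O} → Str H x z → List (Σ y : O, Str H y z × Str H x y)
  | _, nil => [⟨x, nil, nil⟩]
  | z, cons f p => ⟨z, nil, cons f p⟩ :: p.splits.map fun s => ⟨s.1, cons f s.2.1, s.2.2⟩

/-- Add `f` to the first block of a string of blocks (no result if there is no block). -/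
def enlarge {x y z : O} (f : H y z) : Str (Str H) x y → List (Str (Str H) x z)
  | nil => []
  | cons b B => [cons (cons f b) B]

/-- All the ways of cutting a string `(fₙ, …, f₁)` into consecutive nonempty blocks; they
correspond to the `(i_r, …, i₁)` with all `i_j ≥ 1` and `i_r + … + i₁ = n`. -/
def cuts {x : O} : {z : O} → Str H x z → List (Str (Str H) x z)
  | _, nil => [nil]
  | _, cons f p => p.cuts.flatMap fun B => cons (single f) B :: enlarge f B

theorem map_append {O' : Type*} {H' : O' → O' → Type*} (o : O → O')
    (φ : ∀ {x y : O}, H x y → H' (o x) (o y)) {x y : O} {z : O} (p : Str H y z) (q : Str H x y) :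
    (p.append q).map o φ = (p.map o φ).append (q.map o φ) := by
  induction p with
  | nil => rfl
  | cons f p ih => simp only [append, map, ih]

theorem length_map {O' : Type*} {H' : O' → O' → Type*} (o : O → O')
    (φ : ∀ {x y : O}, H x y → H' (o x) (o y)) {x y : O} (p : Str H x y) :
    (p.map o φ).length = p.length := by
  induction p with
  | nil => rfl
  | cons f p ih => simp only [map, length, ih]

theorem sum_cuts_cons {M : Type*} [AddCommMonoid M] {x y z : O} (f : H y z) (p : Str H x y)
    (T : Str (Str H) x z → M) :
    ((cons f p).cuts.map T).sum =
      (p.cuts.map fun B => T (cons (single f) B) + ((enlarge f B).map T).sum).sum := by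
  rw [cuts]
  induction p.cuts with
  | nil => rfl
  | cons B l ih =>
    rw [List.flatMap_cons, List.map_append, List.sum_append, ih, List.map_cons, List.sum_cons,
      List.map_cons, List.sum_cons]

theorem sum_cuts_linear {R : Type*} [CommRing R] {M : Type*} [AddCommGroup M] [Module R M]
    {x y y' : O} (r s : R) (f g h : H y y') (q : Str H x y) {z : O} (p : Str H y' z)
    (T : Str (Str H) x z → M)
    (hT : ∀ {a b : O} (B₁ : Str (Str H) b z) (b₁ : Str H y' b) (b₂ : Str H a y)
      (B₂ : Str (Str H) x a),
      T (B₁.append (cons (b₁.append (cons h b₂)) B₂)) =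
        r • T (B₁.append (cons (b₁.append (cons f b₂)) B₂)) +
        s • T (B₁.append (cons (b₁.append (cons g b₂)) B₂))) :
    ((p.append (cons h q)).cuts.map T).sum =
      r • ((p.append (cons f q)).cuts.map T).sum + s • ((p.append (cons g q)).cuts.map T).sum := by
  induction p with
  | nil =>
    simp only [append, sum_cuts_cons]
    induction q.cuts with
    | nil => simp
    | cons B l ih =>
      simp only [List.map_cons, List.sum_cons, ih, smul_add]
      have h₁ := hT nil nil nil B
      have h₂ : ((enlarge h B).map T).sum =
          r • ((enlarge f B).map T).sum + s • ((enlarge g B).map T).sum := by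
        cases B with
        | nil => simp [enlarge]
        | cons b B => simpa [enlarge, append] using hT nil nil b B
      simp only [append] at h₁
      simp only [single, h₁, h₂]
      abel
  | cons k p ih =>
    simp only [append, sum_cuts_cons]
    refine ih _ fun B₁ b₁ b₂ B₂ => ?_
    have h₁ := hT (cons (single k) B₁) b₁ b₂ B₂
    simp only [append] at h₁
    rw [h₁]
    cases B₁ with
    | nil =>
      have h₂ := hT nil (cons k b₁) b₂ B₂
      simp only [append] at h₂
      simp only [append, enlarge, List.map_cons, List.map_nil, List.sum_cons, List.sum_nil,
        add_zero, h₂, smul_add]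
      abel
    | cons c C =>
      have h₂ := hT (cons (cons k c) C) b₁ b₂ B₂
      simp only [append] at h₂
      simp only [append, enlarge, List.map_cons, List.map_nil, List.sum_cons, List.sum_nil,
        add_zero, h₂, smul_add]
      abel

end Str

/-! ### Graded quivers and formal morphisms -/

/-- A graded quiver over `R`: a set of objects and a `ℤ`-graded `R`-module `Hom x y` for all objects
`x`, `y`; `deg x y d` is its homogeneous part of degree `d`. -/
structure GradedQuiver (R : Type w) [CommRing R] where
  Ob : Type u
  Hom : Ob → Ob → Type v
  [addCommGroup : ∀ x y, AddCommGroup (Hom x y)]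
  [module : ∀ x y, Module R (Hom x y)]
  deg : ∀ x y, ℤ → Submodule R (Hom x y)
  isInternal : ∀ x y, DirectSum.IsInternal (deg x y)

attribute [instance] GradedQuiver.addCommGroup GradedQuiver.module

variable {R : Type w} [CommRing R]

namespace GradedQuiver

variable (Q : GradedQuiver.{w, u, v} R)

/-- The linear map with `f ↦ (-1)^(deg f - 1) f` for homogeneous `f`. -/
noncomputable def sgn {x y : Q.Ob} : Q.Hom x y →ₗ[R] Q.Hom x y :=
  (DirectSum.toModule R ℤ (Q.Hom x y)
      fun d => ((Int.negOnePow (d - 1) : ℤˣ) : ℤ) • (Q.deg x y d).subtype) ∘ₗ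
    (LinearEquiv.ofBijective (DirectSum.coeLinearMap (Q.deg x y)) (Q.isInternal x y)).symm

theorem sgn_of_mem {x y : Q.Ob} {d : ℤ} {f : Q.Hom x y} (hf : f ∈ Q.deg x y d) :
    Q.sgn f = ((Int.negOnePow (d - 1) : ℤˣ) : ℤ) • f := by
  have h : (LinearEquiv.ofBijective (DirectSum.coeLinearMap (Q.deg x y)) (Q.isInternal x y)).symm f
      = DirectSum.lof R ℤ (fun i => Q.deg x y i) d ⟨f, hf⟩ := by
    rw [LinearEquiv.symm_apply_eq]
    exact (DirectSum.coeLinearMap_lof (Q.deg x y) d ⟨f, hf⟩).symm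
  simp only [sgn, LinearMap.comp_apply, LinearEquiv.coe_coe, h, DirectSum.toModule_lof,
    LinearMap.smul_apply, Submodule.subtype_apply]

/-- Apply `sgn` to every entry: a string `(f_d, …, f₁)` of homogeneous morphisms is multiplied, as
an argument of a multilinear map, by `(-1)^(deg f_d + … + deg f₁ - d)`. -/
noncomputable def sgnStr {x y : Q.Ob} (p : Str Q.Hom x y) : Str Q.Hom x y :=
  p.map (fun z => z) (fun f => Q.sgn f)

/-- `Q.HasDeg p e`: all entries of `p = (fₙ, …, f₁)` are homogeneous and
`e = deg fₙ + … + deg f₁`. -/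
inductive HasDeg {x : Q.Ob} : {y : Q.Ob} → Str Q.Hom x y → ℤ → Prop
  | nil : HasDeg Str.nil 0
  | cons {y z : Q.Ob} {f : Q.Hom y z} {p : Str Q.Hom x y} {d e : ℤ} :
      f ∈ Q.deg y z d → HasDeg p e → HasDeg (Str.cons f p) (d + e)

/-- `Q.BlockDeg B t`: all entries of all blocks of `B` are homogeneous and `t` is the sum of all
their reduced degrees `deg f - 1`. -/
inductive BlockDeg {x : Q.Ob} : {y : Q.Ob} → Str (Str Q.Hom) x y → ℤ → Prop
  | nil : BlockDeg Str.nil 0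
  | cons {y z : Q.Ob} {b : Str Q.Hom y z} {B : Str (Str Q.Hom) x y} {d t : ℤ} :
      Q.HasDeg b d → BlockDeg B t → BlockDeg (Str.cons b B) (d - b.length + t)

theorem blockDeg_of_mem_cuts {x y : Q.Ob} {p : Str Q.Hom x y} {e : ℤ} (h : Q.HasDeg p e) :
    ∀ B ∈ p.cuts, Q.BlockDeg B (e - p.length) := by
  induction h with
  | nil =>
    intro B hB
    simp only [Str.cuts, List.mem_singleton] at hB
    subst hB
    simpa [Str.length] using (BlockDeg.nil (Q := Q) (x := x))
  | @cons y z f p d e hf hp ih =>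
    intro B hB
    simp only [Str.cuts, List.mem_flatMap, List.mem_cons] at hB
    obtain ⟨C, hC, rfl | hB⟩ := hB
    · have h₁ := BlockDeg.cons (HasDeg.cons hf HasDeg.nil) (ih C hC)
      have h₂ : d + e - ((Str.cons f p).length : ℤ) =
          d + 0 - ((Str.cons f (Str.nil : Str Q.Hom y y)).length : ℤ) + (e - p.length) := by
        simp only [Str.length]; push_cast; ring
      rw [h₂]; exact h₁
    · have h₀ := ih C hC
      cases C with
      | nil => simp [Str.enlarge] at hB
      | cons b C =>
        simp only [Str.enlarge, List.mem_singleton] at hB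
        subst hB
        generalize ht : e - (p.length : ℤ) = t at h₀
        cases h₀ with
        | cons hb hC' =>
          have h₁ := BlockDeg.cons (HasDeg.cons hf hb) hC'
          convert h₁ using 1
          simp only [Str.length] at ht ⊢; push_cast; linarith

/-- A family of functions on strings is multilinear if it is linear in each entry. -/
structure IsMultilinear {M : Q.Ob → Q.Ob → Type*} [∀ x y, AddCommGroup (M x y)]
    [∀ x y, Module R (M x y)] (T : ∀ {x y : Q.Ob}, Str Q.Hom x y → M x y) : Prop where
  add : ∀ {x y y' z : Q.Ob} (p : Str Q.Hom y' z) (f g : Q.Hom y y') (q : Str Q.Hom x y),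
    T (p.append (.cons (f + g) q)) = T (p.append (.cons f q)) + T (p.append (.cons g q))
  smul : ∀ {x y y' z : Q.Ob} (p : Str Q.Hom y' z) (r : R) (f : Q.Hom y y') (q : Str Q.Hom x y),
    T (p.append (.cons (r • f) q)) = r • T (p.append (.cons f q))

/-- For operations `D` on strings of `Q` and `T` on strings of `Q`, the sum
`∑ (-1)^† T (fₙ, …, f_{d+m+1}, D (f_{d+m}, …, f_{d+1}), f_d, …, f₁)` with
`† = deg f_d + … + deg f₁ - d`, over all `d, m ≥ 0` with `d + m ≤ n`.
(For `m = 0` the curvature element `D ()` is inserted.) -/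
noncomputable def insertSum {M : Q.Ob → Q.Ob → Type*} [∀ x y, AddCommGroup (M x y)]
    (D : ∀ {x y : Q.Ob}, Str Q.Hom x y → Q.Hom x y) (T : ∀ {x y : Q.Ob}, Str Q.Hom x y → M x y)
    {x z : Q.Ob} (p : Str Q.Hom x z) : M x z :=
  (p.splits.map fun s =>
    (s.2.1.splits.map fun t =>
      T (t.2.1.append (.cons (D t.2.2) (Q.sgnStr s.2.2)))).sum).sum

end GradedQuiver

/-- A formal morphism of graded quivers: a map `obj` of objects and, for `n ≥ 1`, multilinear maps
`(fₙ, …, f₁) ↦ map (fₙ, …, f₁)` of degree `1 - n`. There is no component for `n = 0`, so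
the value of `map` at an empty string is set to zero. -/
@[ext]
structure FormalMor (Q₁ Q₂ : GradedQuiver.{w, u, v} R) where
  obj : Q₁.Ob → Q₂.Ob
  map : ∀ {x y : Q₁.Ob}, Str Q₁.Hom x y → Q₂.Hom (obj x) (obj y)
  map_nil : ∀ x : Q₁.Ob, map (.nil : Str Q₁.Hom x x) = 0
  multilinear : Q₁.IsMultilinear (M := fun x y => Q₂.Hom (obj x) (obj y)) map
  map_mem : ∀ {x y : Q₁.Ob} (p : Str Q₁.Hom x y) (e : ℤ), Q₁.HasDeg p e →
    map p ∈ Q₂.deg (obj x) (obj y) (e + 1 - p.length)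

namespace FormalMor

variable {Q₁ Q₂ Q₃ : GradedQuiver.{w, u, v} R}

/-- The linear component `F¹ : Q₁(x, y) → Q₂(F x, F y)`. -/
def map₁ (F : FormalMor Q₁ Q₂) {x y : Q₁.Ob} (f : Q₁.Hom x y) : Q₂.Hom (F.obj x) (F.obj y) :=
  F.map (.single f)

/-- For an operation `T` on strings of `Q₂`, the operation
`(fₙ, …, f₁) ↦ ∑ T (F (fₙ, …), …, F (f_{i₁}, …, f₁))` on strings of `Q₁`; the sum is over all the
cuts of the string into nonempty blocks. -/
def blockSum (F : FormalMor Q₁ Q₂) {M : Q₂.Ob → Q₂.Ob → Type*} [∀ x y, AddCommGroup (M x y)]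
    (T : ∀ {x y : Q₂.Ob}, Str Q₂.Hom x y → M x y) {x y : Q₁.Ob} (p : Str Q₁.Hom x y) :
    M (F.obj x) (F.obj y) :=
  (p.cuts.map fun B => T (B.map F.obj F.map)).sum

theorem blockSum_linear (F : FormalMor Q₁ Q₂) {M : Q₂.Ob → Q₂.Ob → Type*}
    [∀ x y, AddCommGroup (M x y)] [∀ x y, Module R (M x y)]
    (T : ∀ {x y : Q₂.Ob}, Str Q₂.Hom x y → M x y) (hT : Q₂.IsMultilinear T) :
    Q₁.IsMultilinear (M := fun x y => M (F.obj x) (F.obj y)) (F.blockSum T) where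
  add p f g q := by
    have := Str.sum_cuts_linear (1 : R) 1 f g (f + g) q p
      (fun B => T (B.map F.obj F.map)) (fun B₁ b₁ b₂ B₂ => by
        simp only [Str.map_append, Str.map, F.multilinear.add, hT.add, one_smul])
    simp only [one_smul] at this
    exact this
  smul p r f q := by
    have := Str.sum_cuts_linear r 0 f f (r • f) q p
      (fun B => T (B.map F.obj F.map)) (fun B₁ b₁ b₂ B₂ => by
        simp only [Str.map_append, Str.map, F.multilinear.smul, hT.smul, zero_smul, add_zero])
    simp only [zero_smul, add_zero] at this
    exact this

theorem hasDeg_map (F : FormalMor Q₁ Q₂) {x y : Q₁.Ob} {p : Str Q₁.Hom x y} {e : ℤ}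
    (h : Q₁.HasDeg p e) : ∀ B ∈ p.cuts,
      Q₂.HasDeg (B.map F.obj F.map) (e - p.length + B.length) := by
  intro B hB
  have hB' := Q₁.blockDeg_of_mem_cuts h B hB
  generalize e - (p.length : ℤ) = t at hB'
  clear hB h p
  induction hB' with
  | nil => simpa [Str.length, Str.map] using (GradedQuiver.HasDeg.nil (Q := Q₂) (x := F.obj x))
  | @cons y z b B d t hb _ ih =>
    have h₁ := GradedQuiver.HasDeg.cons (F.map_mem b d hb) ih
    have h₂ : d - b.length + t + ((Str.cons b B).length : ℤ) =
        d + 1 - b.length + (t + B.length) := by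
      simp only [Str.length]; push_cast; ring
    rw [h₂]; exact h₁

/-- The composition `G · F` of formal morphisms,
`(G · F) (fₙ, …, f₁) = ∑ G (F (fₙ, …), …, F (f_{i₁}, …, f₁))`. -/
def comp (G : FormalMor Q₂ Q₃) (F : FormalMor Q₁ Q₂) : FormalMor Q₁ Q₃ where
  obj x := G.obj (F.obj x)
  map p := F.blockSum (M := fun x y => Q₃.Hom (G.obj x) (G.obj y)) G.map p
  map_nil x := by simp [blockSum, Str.cuts, Str.map, G.map_nil]
  multilinear := F.blockSum_linear (M := fun x y => Q₃.Hom (G.obj x) (G.obj y)) G.map G.multilinear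
  map_mem {x y} p e h := by
    refine list_sum_mem fun t ht => ?_
    obtain ⟨B, hB, rfl⟩ := List.mem_map.1 ht
    have h₁ := G.map_mem _ _ (F.hasDeg_map h B hB)
    have h₂ : (B.map F.obj F.map).length = B.length := Str.length_map _ _ B
    rw [h₂] at h₁
    convert h₁ using 2
    ring

end FormalMor

/-! ### A-infinity categories and functors -/

/-- An A-infinity structure on a graded quiver: multilinear operations
`(fₙ, …, f₁) ↦ op (fₙ, …, f₁)` of degree `2 - n` for all `n ≥ 0` (the curvature `op ()` need not
vanish), such that, for all strings of homogeneous morphisms,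
`∑ (-1)^† op (fₙ, …, f_{d+m+1}, op (f_{d+m}, …, f_{d+1}), f_d, …, f₁) = 0`,
where `† = deg f_d + … + deg f₁ - d`. -/
structure AInfCat (R : Type w) [CommRing R] extends GradedQuiver.{w, u, v} R where
  op : ∀ {x y : Ob}, Str Hom x y → Hom x y
  op_multilinear : toGradedQuiver.IsMultilinear op
  op_mem : ∀ {x y : Ob} (p : Str Hom x y) (e : ℤ), toGradedQuiver.HasDeg p e →
    op p ∈ deg x y (e + 2 - p.length)
  op_op : ∀ {x y : Ob} (p : Str Hom x y), toGradedQuiver.insertSum op op p = 0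

/-- An A-infinity functor: a formal morphism `F` with
`∑ op (F (fₙ, …), …, F (f_{i₁}, …, f₁)) =
  ∑ (-1)^† F (fₙ, …, f_{d+m+1}, op (f_{d+m}, …, f_{d+1}), f_d, …, f₁)`
for all strings of homogeneous morphisms. -/
structure AInfFunctor (A B : AInfCat.{w, u, v} R) extends
    FormalMor A.toGradedQuiver B.toGradedQuiver where
  map_op : ∀ {x y : A.Ob} (p : Str A.Hom x y),
    toFormalMor.blockSum B.op p =
      A.insertSum (M := fun x y => B.Hom (obj x) (obj y)) A.op map p

/-- A strictly unital A-infinity category. The units are unique. With the sign conventions of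
`AInfCat`, the unit acts on the left by `op (1, f) = (-1)^(deg f) f`. -/
structure SUCat (R : Type w) [CommRing R] extends AInfCat.{w, u, v} R where
  one : ∀ x : Ob, Hom x x
  op_one : ∀ {x y z : Ob} (p : Str Hom y z) (q : Str Hom x y),
    (p.append (.cons (one y) q)).length ≠ 2 → op (p.append (.cons (one y) q)) = 0
  op_one_left : ∀ {x y : Ob} (d : ℤ) (f : Hom x y), f ∈ deg x y d →
    op (.cons (one y) (.single f)) = ((Int.negOnePow d : ℤˣ) : ℤ) • f
  op_one_right : ∀ {x y : Ob} (f : Hom x y), op (.cons f (.single (one x))) = f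

/-- A strictly unital A-infinity functor. -/
structure SUFunctor (A B : SUCat.{w, u, v} R) extends AInfFunctor A.toAInfCat B.toAInfCat where
  map_one : ∀ x : A.Ob, map (.single (A.one x)) = B.one (obj x)
  map_cons_one : ∀ {x y z : A.Ob} (p : Str A.Hom y z) (q : Str A.Hom x y),
    (p.append (.cons (A.one y) q)).length ≠ 1 → map (p.append (.cons (A.one y) q)) = 0

/-- Condition (F1): `F¹ : A(x, y) → B(F x, F y)` is a split surjection of graded modules, for all
objects `x`, `y`. -/
def SUFunctor.F1 {A B : SUCat.{w, u, v} R} (F : SUFunctor A B) : Prop :=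
  ∀ x y : A.Ob, ∃ s : B.Hom (F.obj x) (F.obj y) →ₗ[R] A.Hom x y,
    (∀ d, ∀ g ∈ B.deg (F.obj x) (F.obj y) d, s g ∈ A.deg x y d) ∧
    ∀ g, F.map₁ (s g) = g

/-- The square with `α : P → A''`, `β : P → A`, `F : A → A'`, `G : A'' → A'` is a pullback square in
the category of strictly unital A-infinity categories and strictly unital A-infinity functors:
it commutes and is universal among such squares. A strictly unital A-infinity functor is determined
by its underlying formal morphism, and composition is composition of formal morphisms. -/
structure IsPullback {P A A' A'' : SUCat.{w, u, v} R} (α : SUFunctor P A'') (β : SUFunctor P A)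
    (F : SUFunctor A A') (G : SUFunctor A'' A') : Prop where
  comm : F.toFormalMor.comp β.toFormalMor = G.toFormalMor.comp α.toFormalMor
  existsUnique : ∀ (C : SUCat.{w, u, v} R) (L : SUFunctor C A'') (I : SUFunctor C A),
    F.toFormalMor.comp I.toFormalMor = G.toFormalMor.comp L.toFormalMor →
    ∃! N : SUFunctor C P, α.toFormalMor.comp N.toFormalMor = L.toFormalMor ∧
      β.toFormalMor.comp N.toFormalMor = I.toFormalMor

end AInf

/-! In bar language, `blockSum` is precomposition with the cofunctor of a formal morphism and
`insertSum` is precomposition with the coderivation of an operation; the signs are those of the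
reduced degrees `deg f - 1`. Everything is a finite sum over cuts and splittings of strings, so no
flatness enters.

Take the quiver of pairs `(a, a'')` with `F¹ a = G¹ a''`, and let `α` be the projection to `A''`
with only a linear component. The projection `β` to `A` starts with `β¹ (a, a'') = a` and usually
needs higher components: the equation `F · β = G · α` prescribes `F¹` of the component of order `n`
in terms of lower ones, and a graded section `s` of `F¹` picks a solution (`toLeft`, `comp_toLeft`).

Compatibility with `α` and `β` dictates both entries of the operations on the pullback, by recursion
on the length. The point is that the dictated pair is again in the pullback. `opStep` forces this by
adding a term in the image of `s` to the first entry. By `comp_defect`, and since `G · α = F · β` is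
already compatible with the operations, `F¹` kills the resulting defect of `β`. The defect lies in
the image of `s`, where `F¹` is injective, so it is zero (`toLeft_op`). The A-infinity relations
follow because `β¹` and `α¹` are jointly injective and both kill the first possible failure
(`insertSum_insertSum`, `insertSum_insertSum_eq_zero`). The unit laws follow from joint injectivity
in the same way (`lin_op_unit`, `op_one`).

For the universal property, `α · N` and `β · N` determine `N` recursively (`formalMor_ext`).
Existence uses the same recursion; `toLeft_comp_induced` repeats the argument with the image of `s`,
and `induced_op` gets compatibility from `comp_defect` for both projections. -/

namespace AInf

/-! ### Combinatorics of splitting and cutting strings. -/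

namespace Str

variable {O : Type u} {H : O → O → Type v}

theorem length_append {x y : O} {z : O} (p : Str H y z) (q : Str H x y) :
    (p.append q).length = p.length + q.length := by
  induction p with
  | nil => simp [append, length]
  | cons f p ih => simp only [append, length, ih]; omega

theorem append_nil {x y : O} (p : Str H x y) : p.append nil = p := by
  induction p with
  | nil => rfl
  | cons f p ih => simp only [append, ih]

theorem append_assoc {t x y z : O} (p : Str H y z) (q : Str H x y) (r : Str H t x) :
    (p.append q).append r = p.append (q.append r) := by
  induction p with
  | nil => rfl
  | cons f p ih => simp only [append, ih]

theorem length_append_cons {x y y' z : O} (p : Str H y' z) (f : H y y') (q : Str H x y) :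
    (p.append (cons f q)).length = p.length + q.length + 1 := by
  simp only [length_append, length]; omega

/-! #### Sums over splittings -/

section Splits

variable {M : Type*} [AddCommMonoid M]

/-- The sum of `W a b` over all ways of writing `p` as a concatenation `a.append b`. -/
def sumSplits {x z : O} (p : Str H x z) (W : ∀ y, Str H y z → Str H x y → M) : M :=
  (p.splits.map fun s => W s.1 s.2.1 s.2.2).sum

theorem sumSplits_nil {x : O} (W : ∀ y, Str H y x → Str H x y → M) :
    sumSplits (nil : Str H x x) W = W x nil nil := by
  simp [sumSplits, splits]

theorem sumSplits_cons {x y z : O} (f : H y z) (p : Str H x y)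
    (W : ∀ y, Str H y z → Str H x y → M) :
    sumSplits (cons f p) W = W z nil (cons f p) + sumSplits p fun t a b => W t (cons f a) b := by
  simp [sumSplits, splits, Function.comp_def]

theorem sumSplits_congr {x z : O} {p : Str H x z} {W W' : ∀ y, Str H y z → Str H x y → M}
    (h : ∀ y (a : Str H y z) (b : Str H x y), a.length + b.length = p.length → W y a b = W' y a b) :
    sumSplits p W = sumSplits p W' := by
  induction p with
  | nil => simp only [sumSplits_nil]; exact h _ _ _ rfl
  | cons f p ih =>
    simp only [sumSplits_cons]
    rw [h _ nil (cons f p) (by simp [length])]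
    congr 1
    refine ih fun y a b hab => h _ _ _ ?_
    simp only [length] at hab ⊢; omega

theorem sumSplits_eq_zero {x z : O} {p : Str H x z} {W : ∀ y, Str H y z → Str H x y → M}
    (h : ∀ y (a : Str H y z) (b : Str H x y), a.length + b.length = p.length → W y a b = 0) :
    sumSplits p W = 0 := by
  rw [sumSplits_congr (W' := fun _ _ _ => 0) h]
  simp [sumSplits]

theorem sumSplits_add {x z : O} (p : Str H x z) (W W' : ∀ y, Str H y z → Str H x y → M) :
    (sumSplits p fun t a b => W t a b + W' t a b) = sumSplits p W + sumSplits p W' := by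
  simp [sumSplits, List.sum_map_add]

theorem map_sumSplits {N F : Type*} [AddCommMonoid N] [FunLike F M N] [AddMonoidHomClass F M N]
    (φ : F) {x z : O} (p : Str H x z) (W : ∀ y, Str H y z → Str H x y → M) :
    φ (sumSplits p W) = sumSplits p fun t a b => φ (W t a b) := by
  simp [sumSplits, map_list_sum, Function.comp_def]

theorem sumSplits_neg {N : Type*} [AddCommGroup N] {x z : O} (p : Str H x z)
    (W : ∀ y, Str H y z → Str H x y → N) :
    -sumSplits p W = sumSplits p fun t a b => -W t a b :=
  map_sumSplits (negAddMonoidHom : N →+ N) p W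

theorem sumSplits_append_cons {x y y' z : O} (p : Str H y' z) (u : H y y') (q : Str H x y)
    (W : ∀ y, Str H y z → Str H x y → M) :
    sumSplits (p.append (cons u q)) W =
      (sumSplits p fun t a b => W t a (b.append (cons u q))) +
        sumSplits q fun t a b => W t (p.append (cons u a)) b := by
  induction p with
  | nil => simp only [append, sumSplits_cons, sumSplits_nil]
  | cons f p ih => simp only [append, sumSplits_cons, ih, add_assoc]

theorem sumSplits_map {O' : Type*} {H' : O' → O' → Type*} (o : O → O')
    (φ : ∀ {x y : O}, H x y → H' (o x) (o y)) {x z : O} (p : Str H x z)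
    (W : ∀ y, Str H' y (o z) → Str H' (o x) y → M) :
    sumSplits (p.map o φ) W = sumSplits p fun t a b => W (o t) (a.map o φ) (b.map o φ) := by
  induction p with
  | nil => simp only [map, sumSplits_nil]
  | cons f p ih => simp only [map, sumSplits_cons, ih]

/-- Coassociativity of deconcatenation: both sides run over all ways of cutting `p` at two places.
-/
theorem sumSplits_assoc {x z : O} (p : Str H x z)
    (W : ∀ s t, Str H t z → Str H s t → Str H x s → M) :
    (sumSplits p fun s r c => sumSplits r fun t a b => W s t a b c) =
      sumSplits p fun t a r => sumSplits r fun s b c => W s t a b c := by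
  induction p with
  | nil => simp only [sumSplits_nil]
  | cons f p ih => simp only [sumSplits_cons, sumSplits_nil, sumSplits_add, ih, add_assoc]

theorem sumSplits_of_left {x z : O} {p : Str H x z} {W : ∀ y, Str H y z → Str H x y → M}
    (h : ∀ y (a : Str H y z) (b : Str H x y), a.length + b.length = p.length → b.length ≠ 0 →
      W y a b = 0) : sumSplits p W = W x p nil := by
  induction p with
  | nil => simp only [sumSplits_nil]
  | cons f p ih =>
    rw [sumSplits_cons, h _ nil (cons f p) (by simp [length]) (by simp [length]), zero_add]
    refine ih fun y a b hab hb => h _ _ _ ?_ hb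
    simp only [length] at hab ⊢; omega

theorem sumSplits_of_right {x z : O} {p : Str H x z} {W : ∀ y, Str H y z → Str H x y → M}
    (h : ∀ y (a : Str H y z) (b : Str H x y), a.length + b.length = p.length → a.length ≠ 0 →
      W y a b = 0) : sumSplits p W = W z nil p := by
  cases p with
  | nil => simp only [sumSplits_nil]
  | cons f p =>
    rw [sumSplits_cons, sumSplits_eq_zero, add_zero]
    intro y a b hab
    refine h _ _ _ ?_ (by simp [length])
    simp only [length] at hab ⊢; omega

theorem sumSplits_comm {x z x' z' : O} (p : Str H x z) (q : Str H x' z')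
    (W : ∀ s, Str H s z → Str H x s → ∀ t, Str H t z' → Str H x' t → M) :
    (sumSplits p fun s a b => sumSplits q fun t c d => W s a b t c d) =
      sumSplits q fun t c d => sumSplits p fun s a b => W s a b t c d := by
  induction p with
  | nil => simp only [sumSplits_nil]
  | cons f p ih => simp only [sumSplits_cons, sumSplits_add, ih]

/-- Both sides run over all factorizations `a₁ a₂ b c₁ c₂` of `p`. The left side selects the inner
window `b` first, the right side the outer window `a₂ b c₁`; this is the bookkeeping for nested
insertions. -/
theorem sumSplits_five {x z : O} (p : Str H x z)
    (W : ∀ s t s' t', Str H t' z → Str H t t' → Str H s t → Str H s' s → Str H x s' → M) :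
    (sumSplits p fun s r c => sumSplits r fun t a b => sumSplits a fun t' a₁ a₂ =>
      sumSplits c fun s' c₁ c₂ => W s t s' t' a₁ a₂ b c₁ c₂) =
    sumSplits p fun s' r c₂ => sumSplits r fun t' a₁ y => sumSplits y fun s v c₁ =>
      sumSplits v fun t a₂ b => W s t s' t' a₁ a₂ b c₁ c₂ := by
  simp only [← sumSplits_assoc]
  rw [sumSplits_assoc (W := fun s' s m c₁ c₂ => sumSplits m fun t a b => sumSplits a fun t' a₁ a₂ =>
    W s t s' t' a₁ a₂ b c₁ c₂)]
  refine sumSplits_congr fun s r c _ => ?_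
  rw [sumSplits_comm]
  refine sumSplits_congr fun t a b _ => ?_
  rw [sumSplits_comm]

/-- The analogue for two disjoint windows in `a₀ b₀ a b c`: the left window `b₀` or the right window
`b` may be selected first. -/
theorem sumSplits_five' {x z : O} (p : Str H x z)
    (W : ∀ s t s' t', Str H t z → Str H s t → Str H t' s → Str H s' t' → Str H x s' → M) :
    (sumSplits p fun s r₀ c₀ => sumSplits r₀ fun t a₀ b₀ => sumSplits c₀ fun s' r c =>
      sumSplits r fun t' a b => W s t s' t' a₀ b₀ a b c) =
    sumSplits p fun s' m c => sumSplits m fun t' n b => sumSplits n fun s r₀ a =>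
      sumSplits r₀ fun t a₀ b₀ => W s t s' t' a₀ b₀ a b c := by
  rw [sumSplits_congr fun s r₀ c₀ _ => sumSplits_comm r₀ c₀ fun t a₀ b₀ s' r c =>
    sumSplits r fun t' a b => W s t s' t' a₀ b₀ a b c]
  rw [← sumSplits_assoc (W := fun s' s r₀ r c => sumSplits r₀ fun t a₀ b₀ =>
    sumSplits r fun t' a b => W s t s' t' a₀ b₀ a b c)]
  refine sumSplits_congr fun s' m c _ => ?_
  rw [sumSplits_assoc m fun t' s r₀ a b => sumSplits r₀ fun t a₀ b₀ => W s t s' t' a₀ b₀ a b c]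
  refine sumSplits_congr fun s r₀ r _ => ?_
  rw [sumSplits_comm]

end Splits

/-! #### Sums over cuts -/

section Cuts

variable {M : Type*} [AddCommMonoid M]

/-- The sum of `W B` over all ways `B` of cutting `p` into consecutive nonempty blocks. -/
def sumCuts {x z : O} (p : Str H x z) (W : Str (Str H) x z → M) : M :=
  (p.cuts.map W).sum

theorem sumCuts_nil {x : O} (W : Str (Str H) x x → M) :
    sumCuts (nil : Str H x x) W = W nil := by
  simp [sumCuts, cuts]

theorem sumCuts_add {x z : O} (p : Str H x z) (W W' : Str (Str H) x z → M) :
    (sumCuts p fun B => W B + W' B) = sumCuts p W + sumCuts p W' := by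
  simp [sumCuts, List.sum_map_add]

theorem sumCuts_zero {x z : O} (p : Str H x z) :
    (sumCuts p fun _ => (0 : M)) = 0 := by
  simp [sumCuts]

theorem map_sumCuts {N F : Type*} [AddCommMonoid N] [FunLike F M N] [AddMonoidHomClass F M N]
    (φ : F) {x z : O} (p : Str H x z) (W : Str (Str H) x z → M) :
    φ (sumCuts p W) = sumCuts p fun B => φ (W B) := by
  simp [sumCuts, map_list_sum, Function.comp_def]

/-- Evaluate `W` at the string of blocks whose first block is enlarged by `f`; zero if there is no
block. -/
def enlargeSum {x y z : O} (f : H y z) (W : Str (Str H) x z → M) : Str (Str H) x y → M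
  | nil => 0
  | cons b B => W (cons (cons f b) B)

theorem sumCuts_cons' {x y z : O} (f : H y z) (p : Str H x y) (W : Str (Str H) x z → M) :
    sumCuts (cons f p) W = sumCuts p fun B => W (cons (single f) B) + enlargeSum f W B := by
  rw [sumCuts, sum_cuts_cons]
  unfold sumCuts
  congr 2
  funext B
  cases B <;> simp [enlarge, enlargeSum]

/-- A sum over cuts, organized by the first block. -/
theorem sumCuts_cons {x y z : O} (f : H y z) (p : Str H x y) (W : Str (Str H) x z → M) :
    sumCuts (cons f p) W =
      sumSplits p fun _ b c => sumCuts c fun C => W (cons (cons f b) C) := by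
  induction p generalizing z with
  | nil => simp [sumCuts_cons', sumCuts_nil, sumSplits_nil, enlargeSum, single]
  | cons g p ih =>
    rw [sumCuts_cons', sumCuts_add, ih _ (enlargeSum f W), sumSplits_cons]
    rfl

/-- A sum over cuts, organized by the block containing the marked entry `u`. -/
theorem sumCuts_append_cons {x y y' z : O} (p : Str H y' z) (u : H y y') (q : Str H x y)
    (W : Str (Str H) x z → M) :
    sumCuts (p.append (cons u q)) W =
      sumSplits p fun _ a b => sumCuts a fun A => sumSplits q fun _ b' c => sumCuts c fun C =>
        W (A.append (cons (b.append (cons u b')) C)) := by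
  generalize hn : p.length = n
  induction n using Nat.strong_induction_on generalizing z with
  | _ n ih =>
    cases p with
    | nil => simp only [append, sumCuts_cons, sumSplits_nil, sumCuts_nil]
    | cons k p =>
      simp only [append, sumCuts_cons, sumSplits_cons, sumSplits_append_cons, sumCuts_nil]
      -- Either the first block reaches `u`, and then no block precedes the marked one, or it ends
      -- inside `p`, and what remains has a shorter part before `u`.
      rw [add_comm]
      congr 1
      rw [sumSplits_assoc]
      refine sumSplits_congr fun t a b hab => ?_
      refine ih b.length ?_ b _ rfl
      simp only [length] at hn; omega

theorem sumCuts_map {O' : Type*} {H' : O' → O' → Type*} (o : O → O')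
    (φ : ∀ {x y : O}, H x y → H' (o x) (o y)) {x z : O} (p : Str H x z)
    (W : Str (Str H') (o x) (o z) → M) :
    sumCuts (p.map o φ) W = sumCuts p fun B => W (B.map o fun b => b.map o φ) := by
  induction p with
  | nil => simp only [map, sumCuts_nil]
  | cons f p ih =>
    simp only [map, sumCuts_cons', ih]
    congr 1
    funext B
    cases B <;> rfl

/-- Cutting and splitting commute. -/
theorem sumCuts_sumSplits {x z : O} (p : Str H x z)
    (W : ∀ y, Str (Str H) y z → Str (Str H) x y → M) :
    (sumCuts p fun B => sumSplits B W) =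
      sumSplits p fun t a b => sumCuts a fun A => sumCuts b fun B => W t A B := by
  generalize hn : p.length = n
  induction n using Nat.strong_induction_on generalizing z with
  | _ n ih =>
    cases p with
    | nil => simp only [sumCuts_nil, sumSplits_nil]
    | cons k p =>
      simp only [sumSplits_cons, sumCuts_nil, sumCuts_cons, sumSplits_add, sumCuts_add]
      congr 1
      rw [sumSplits_assoc]
      refine sumSplits_congr fun t a b hab => ?_
      refine ih b.length ?_ b _ rfl
      simp only [length] at hn; omega

/-- Sums over the cuts of `p` only depend on the values of `φ` on strings not longer than `p`. -/
theorem sumCuts_map_congr {O' : Type*} {H' : O' → O' → Type*} {o : O → O'}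
    {φ φ' : ∀ {x y : O}, Str H x y → H' (o x) (o y)} {x z : O} {p : Str H x z}
    (h : ∀ {x y : O} (q : Str H x y), q.length ≤ p.length → φ q = φ' q)
    (W : Str H' (o x) (o z) → M) :
    (sumCuts p fun B => W (B.map o φ)) = sumCuts p fun B => W (B.map o φ') := by
  generalize hn : p.length = n
  induction n using Nat.strong_induction_on generalizing z with
  | _ n ih =>
    cases p with
    | nil => simp only [sumCuts_nil, map]
    | cons k p =>
      simp only [sumCuts_cons, map]
      refine sumSplits_congr fun t a b hab => ?_
      simp only [length] at hn h
      rw [h _ (by simp only [length]; omega)]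
      exact ih b.length (by omega) (fun q hq => h q (by omega)) (fun q => W (cons _ q)) rfl

/-- Only the block of maximal length contributes to a sum over cuts if `W` vanishes on
strings of length at least two. -/
theorem sumCuts_of_length {x z : O} {p : Str H x z} (hp : p.length ≠ 0) {W : Str (Str H) x z → M}
    (h : ∀ B : Str (Str H) x z, 2 ≤ B.length → W B = 0) : sumCuts p W = W (single p) := by
  cases p with
  | nil => simp [length] at hp
  | cons f p =>
    rw [sumCuts_cons, sumSplits_of_left]
    · rw [sumCuts_nil]; rfl
    · intro y a b hab hb
      cases b with
      | nil => simp [length] at hb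
      | cons g b =>
        rw [sumCuts_cons]
        refine sumSplits_eq_zero fun t c d _ => ?_
        rw [← sumCuts_zero (M := M) d]
        congr 1
        funext C
        exact h _ (by simp [length])

/-- Sums over the cuts of `p` into at least two blocks only depend on the values of `φ` on strings
shorter than `p`. -/
theorem sumCuts_map_congr_of_lt {O' : Type*} {H' : O' → O' → Type*} {o : O → O'}
    {φ φ' : ∀ {x y : O}, Str H x y → H' (o x) (o y)} {x z : O} {p : Str H x z}
    (h : ∀ {x y : O} (q : Str H x y), q.length < p.length → φ q = φ' q)
    {W : Str H' (o x) (o z) → M} (hW : ∀ q, q.length < 2 → W q = 0) :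
    (sumCuts p fun B => W (B.map o φ)) = sumCuts p fun B => W (B.map o φ') := by
  cases p with
  | nil => simp only [sumCuts_nil, map]
  | cons k p =>
    simp only [sumCuts_cons, map]
    refine sumSplits_congr fun t a b hab => ?_
    -- If the first block is the whole string, the hypothesis on `φ` says nothing, but then there is
    -- only one block and `W` vanishes.
    cases b with
    | nil => simp only [sumCuts_nil, map]; rw [hW _ (by simp [length]), hW _ (by simp [length])]
    | cons g b =>
      simp only [length] at hab h
      rw [h _ (by simp only [length]; omega)]
      exact sumCuts_map_congr (fun q hq => h q (by simp only [length] at hq; omega))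
        fun q => W (cons _ q)

theorem sumCuts_sumSplits_comm {x z x' z' : O} (p : Str H x z) (q : Str H x' z')
    (W : Str (Str H) x z → ∀ t, Str H t z' → Str H x' t → M) :
    (sumCuts p fun A => sumSplits q fun t a b => W A t a b) =
      sumSplits q fun t a b => sumCuts p fun A => W A t a b := by
  induction q with
  | nil => simp only [sumSplits_nil]
  | cons f q ih => simp only [sumSplits_cons, sumCuts_add, ih]

theorem sumCuts_comm {x z x' z' : O} (p : Str H x z) (q : Str H x' z')
    (W : Str (Str H) x z → Str (Str H) x' z' → M) :
    (sumCuts p fun A => sumCuts q fun B => W A B) = sumCuts q fun B => sumCuts p fun A => W A B := by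
  unfold sumCuts
  induction p.cuts with
  | nil => simp
  | cons A l ih => simp [List.sum_map_add, ih]

end Cuts

/-! #### Operations determined by recursion on the length of the string -/

/-- The iterates of `Φ` stabilize on strings of length `n` from iterate `n + 1` on, and `φ` takes
these stable values. As `good` concerns a whole family, it holds for each iterate; the limit is only
known to agree with a good iterate up to any given length. -/
theorem exists_fixedPoint {M : O → O → Type*}
    (Φ : (∀ x y, Str H x y → M x y) → ∀ x y, Str H x y → M x y)
    (hΦ : ∀ (φ φ' : ∀ x y, Str H x y → M x y) {x y : O} (p : Str H x y),
      (∀ x y (q : Str H x y), q.length < p.length → φ x y q = φ' x y q) → Φ φ x y p = Φ φ' x y p)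
    (good : (∀ x y, Str H x y → M x y) → Prop) {φ₀ : ∀ x y, Str H x y → M x y} (h₀ : good φ₀)
    (h : ∀ φ, good φ → good (Φ φ)) :
    ∃ φ : ∀ x y, Str H x y → M x y, (∀ x y p, φ x y p = Φ φ x y p) ∧
      ∀ n : ℕ, ∃ γ, good γ ∧ ∀ x y p, p.length ≤ n → φ x y p = γ x y p := by
  have stable : ∀ k j, k ≤ j → ∀ x y (p : Str H x y), p.length < k →
      Φ^[k] φ₀ x y p = Φ^[j] φ₀ x y p := by
    intro k
    induction k with
    | zero => intro j _ x y p hp; omega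
    | succ k ih =>
      intro j hj x y p hp
      obtain ⟨j, rfl⟩ : ∃ i, j = i + 1 := ⟨j - 1, by omega⟩
      rw [Function.iterate_succ_apply', Function.iterate_succ_apply']
      exact hΦ _ _ _ fun x y q hq => ih j (by omega) x y q (by omega)
  have good_iterate : ∀ k, good (Φ^[k] φ₀) := by
    intro k
    induction k with
    | zero => exact h₀
    | succ k ih => rw [Function.iterate_succ_apply']; exact h _ ih
  refine ⟨fun x y p => Φ^[p.length + 1] φ₀ x y p, fun x y p => ?_, fun n =>
    ⟨Φ^[n + 1] φ₀, good_iterate _, fun x y p hp => stable _ _ (by omega) _ _ _ (by omega)⟩⟩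
  dsimp only
  rw [Function.iterate_succ_apply']
  exact hΦ _ _ _ fun x y q hq => (stable _ _ (by omega) _ _ _ (by omega)).symm

/-- Keep only the values of an operation on strings of length at least two. -/
def high {M : O → O → Type*} [∀ x y, Zero (M x y)] (T : ∀ {x y : O}, Str H x y → M x y)
    {x y : O} (p : Str H x y) : M x y :=
  if p.length < 2 then 0 else T p

/-- The entry of a string of length one; zero for all other strings. -/
def entry [∀ x y, Zero (H x y)] {x : O} : {y : O} → Str H x y → H x y
  | _, nil => 0
  | _, cons f nil => f
  | _, cons _ (cons _ _) => 0

end Str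

end AInf

/-! ### Signs, multilinear operations and insertion sums on graded quivers. -/

namespace AInf

open Str

variable {R : Type w} [CommRing R]

namespace GradedQuiver

variable {Q : GradedQuiver.{w, u, v} R}

/-! #### Homogeneous elements and signs -/

theorem span_homogeneous {x y : Q.Ob} {S : Submodule R (Q.Hom x y)} (h : ∀ d, Q.deg x y d ≤ S)
    (f : Q.Hom x y) : f ∈ S := by
  have := (Q.isInternal x y).submodule_iSup_eq_top
  exact (iSup_le h : ⨆ d, Q.deg x y d ≤ S) (this ▸ Submodule.mem_top)

theorem linearMap_ext {M : Type*} [AddCommGroup M] [Module R M] {x y : Q.Ob}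
    {φ ψ : Q.Hom x y →ₗ[R] M} (h : ∀ d, ∀ f ∈ Q.deg x y d, φ f = ψ f) : φ = ψ := by
  ext f
  exact span_homogeneous (S := LinearMap.eqLocus φ ψ) h f

theorem sgn_mem {x y : Q.Ob} {d : ℤ} {f : Q.Hom x y} (hf : f ∈ Q.deg x y d) :
    Q.sgn f ∈ Q.deg x y d := by
  rw [Q.sgn_of_mem hf]
  exact zsmul_mem hf _

theorem sgn_sgn {x y : Q.Ob} (f : Q.Hom x y) : Q.sgn (Q.sgn f) = f := by
  have : Q.sgn ∘ₗ Q.sgn = (LinearMap.id : Q.Hom x y →ₗ[R] Q.Hom x y) := by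
    refine linearMap_ext fun d f hf => ?_
    rw [LinearMap.comp_apply, Q.sgn_of_mem hf, map_zsmul, Q.sgn_of_mem hf, smul_smul,
      ← Units.val_mul, Int.units_mul_self]
    simp
  exact LinearMap.congr_fun this f

theorem sgnStr_append {x y z : Q.Ob} (p : Str Q.Hom y z) (q : Str Q.Hom x y) :
    Q.sgnStr (p.append q) = (Q.sgnStr p).append (Q.sgnStr q) :=
  map_append _ _ p q

theorem sgnStr_nil {x : Q.Ob} : Q.sgnStr (nil : Str Q.Hom x x) = nil := rfl

theorem sgnStr_cons {x y z : Q.Ob} (f : Q.Hom y z) (p : Str Q.Hom x y) :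
    Q.sgnStr (cons f p) = cons (Q.sgn f) (Q.sgnStr p) := rfl

theorem length_sgnStr {x y : Q.Ob} (p : Str Q.Hom x y) : (Q.sgnStr p).length = p.length :=
  length_map _ _ p

theorem sgnStr_sgnStr {x y : Q.Ob} (p : Str Q.Hom x y) : Q.sgnStr (Q.sgnStr p) = p := by
  induction p with
  | nil => rfl
  | cons f p ih => rw [sgnStr_cons, sgnStr_cons, ih, sgn_sgn]

theorem HasDeg.append {x y z : Q.Ob} {p : Str Q.Hom y z} {q : Str Q.Hom x y} {d e : ℤ}
    (hp : Q.HasDeg p d) (hq : Q.HasDeg q e) : Q.HasDeg (p.append q) (d + e) := by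
  induction hp with
  | nil => simpa [Str.append] using hq
  | cons hf _ ih => rw [add_assoc]; exact HasDeg.cons hf ih

theorem HasDeg.sgnStr {x y : Q.Ob} {p : Str Q.Hom x y} {d : ℤ} (hp : Q.HasDeg p d) :
    Q.HasDeg (Q.sgnStr p) d := by
  induction hp with
  | nil => exact HasDeg.nil
  | cons hf _ ih => exact HasDeg.cons (sgn_mem hf) ih

theorem HasDeg.single {x y : Q.Ob} {f : Q.Hom x y} {d : ℤ} (hf : f ∈ Q.deg x y d) :
    Q.HasDeg (Str.single f) d := by
  rw [← add_zero d]; exact HasDeg.cons hf HasDeg.nil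

theorem sumSplits_mem {N : Type*} [AddCommGroup N] [Module R N] {S : Submodule R N}
    {x z : Q.Ob} {p : Str Q.Hom x z} {e : ℤ} (hp : Q.HasDeg p e)
    {W : ∀ y, Str Q.Hom y z → Str Q.Hom x y → N}
    (h : ∀ y (a : Str Q.Hom y z) (b : Str Q.Hom x y) (d d' : ℤ), Q.HasDeg a d → Q.HasDeg b d' →
      d + d' = e → a.length + b.length = p.length → W y a b ∈ S) : sumSplits p W ∈ S := by
  induction hp with
  | nil => rw [sumSplits_nil]; exact h _ _ _ _ _ HasDeg.nil HasDeg.nil rfl rfl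
  | @cons y z f p d e hf hp ih =>
    rw [sumSplits_cons]
    refine add_mem (h _ _ _ _ _ HasDeg.nil (HasDeg.cons hf hp) (zero_add _) (by simp [length])) ?_
    refine ih fun t a b d₁ d₂ ha hb hd hl =>
      h _ _ _ _ _ (HasDeg.cons hf ha) hb (by rw [← hd, add_assoc]) ?_
    simp only [length] at hl ⊢; omega

theorem sumSplits_sgnStr {N : Type*} [AddCommMonoid N] {x z : Q.Ob} (p : Str Q.Hom x z)
    (W : ∀ y, Str Q.Hom y z → Str Q.Hom x y → N) :
    sumSplits (Q.sgnStr p) W = sumSplits p fun t a b => W t (Q.sgnStr a) (Q.sgnStr b) :=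
  sumSplits_map (fun z => z) (fun f => Q.sgn f) p W

/-! #### Multilinear operations -/

section Multilinear

variable {M : Q.Ob → Q.Ob → Type*} [∀ x y, AddCommGroup (M x y)] [∀ x y, Module R (M x y)]

/-- The linear map obtained from a multilinear operation by fixing all entries but one. -/
def IsMultilinear.slot {T : ∀ {x y : Q.Ob}, Str Q.Hom x y → M x y} (hT : Q.IsMultilinear T)
    {x y y' z : Q.Ob} (p : Str Q.Hom y' z) (q : Str Q.Hom x y) : Q.Hom y y' →ₗ[R] M x z where
  toFun f := T (p.append (.cons f q))
  map_add' f g := hT.add p f g q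
  map_smul' r f := hT.smul p r f q

theorem IsMultilinear.slot_apply {T : ∀ {x y : Q.Ob}, Str Q.Hom x y → M x y}
    (hT : Q.IsMultilinear T) {x y y' z : Q.Ob} (p : Str Q.Hom y' z) (q : Str Q.Hom x y)
    (f : Q.Hom y y') : hT.slot p q f = T (p.append (.cons f q)) := rfl

/-- An operation that is given by linear maps in each entry is multilinear. -/
theorem IsMultilinear.of_linear {T : ∀ {x y : Q.Ob}, Str Q.Hom x y → M x y}
    (h : ∀ {x y y' z : Q.Ob} (p : Str Q.Hom y' z) (q : Str Q.Hom x y),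
      ∃ φ : Q.Hom y y' →ₗ[R] M x z, ∀ f, T (p.append (.cons f q)) = φ f) : Q.IsMultilinear T where
  add p f g q := by obtain ⟨φ, hφ⟩ := h p q; simp only [hφ, map_add]
  smul p r f q := by obtain ⟨φ, hφ⟩ := h p q; simp only [hφ, map_smul]

theorem IsMultilinear.zero : Q.IsMultilinear (M := M) fun {_ _} _ => 0 where
  add _ _ _ _ := (add_zero 0).symm
  smul _ _ _ _ := (smul_zero _).symm

theorem IsMultilinear.comp {N : Q.Ob → Q.Ob → Type*} [∀ x y, AddCommGroup (N x y)]
    [∀ x y, Module R (N x y)] {T : ∀ {x y : Q.Ob}, Str Q.Hom x y → M x y}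
    (hT : Q.IsMultilinear T) (φ : ∀ x y, M x y →ₗ[R] N x y) :
    Q.IsMultilinear (M := N) fun {x y} p => φ x y (T p) where
  add p f g q := by simp only [hT.add, map_add]
  smul p r f q := by simp only [hT.smul, map_smul]

theorem IsMultilinear.add' {T T' : ∀ {x y : Q.Ob}, Str Q.Hom x y → M x y}
    (hT : Q.IsMultilinear T) (hT' : Q.IsMultilinear T') :
    Q.IsMultilinear (M := M) fun {_ _} p => T p + T' p where
  add p f g q := by simp only [hT.add, hT'.add]; abel
  smul p r f q := by simp only [hT.smul, hT'.smul, smul_add]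

theorem IsMultilinear.sub {T T' : ∀ {x y : Q.Ob}, Str Q.Hom x y → M x y}
    (hT : Q.IsMultilinear T) (hT' : Q.IsMultilinear T') :
    Q.IsMultilinear (M := M) fun {_ _} p => T p - T' p where
  add p f g q := by simp only [hT.add, hT'.add]; abel
  smul p r f q := by simp only [hT.smul, hT'.smul, smul_sub]

theorem IsMultilinear.prod {N : Q.Ob → Q.Ob → Type*} [∀ x y, AddCommGroup (N x y)]
    [∀ x y, Module R (N x y)] {T : ∀ {x y : Q.Ob}, Str Q.Hom x y → M x y}
    {T' : ∀ {x y : Q.Ob}, Str Q.Hom x y → N x y}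
    (hT : Q.IsMultilinear T) (hT' : Q.IsMultilinear T') :
    Q.IsMultilinear (M := fun x y => M x y × N x y) fun {_ _} p => (T p, T' p) where
  add p f g q := by simp only [hT.add, hT'.add, Prod.mk_add_mk]
  smul p r f q := by simp only [hT.smul, hT'.smul, Prod.smul_mk]

theorem IsMultilinear.high {T : ∀ {x y : Q.Ob}, Str Q.Hom x y → M x y}
    (hT : Q.IsMultilinear T) : Q.IsMultilinear (Str.high T) where
  add p f g q := by
    simp only [Str.high, length_append_cons, hT.add]
    split_ifs <;> simp
  smul p r f q := by
    simp only [Str.high, length_append_cons, hT.smul]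
    split_ifs <;> simp

theorem IsMultilinear.sgnStr {T : ∀ {x y : Q.Ob}, Str Q.Hom x y → M x y}
    (hT : Q.IsMultilinear T) : Q.IsMultilinear (M := M) fun {_ _} p => T (Q.sgnStr p) where
  add p f g q := by simp only [sgnStr_append, sgnStr_cons, map_add, hT.add]
  smul p r f q := by simp only [sgnStr_append, sgnStr_cons, map_smul, hT.smul]

theorem IsMultilinear.entry : Q.IsMultilinear (M := Q.Hom) Str.entry := by
  refine IsMultilinear.of_linear fun {x y y' z} p q => ?_
  cases p with
  | nil =>
    cases q with
    | nil => exact ⟨LinearMap.id, fun _ => rfl⟩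
    | cons => exact ⟨0, fun _ => rfl⟩
  | cons g p =>
    refine ⟨0, fun f => ?_⟩
    cases p <;> rfl

theorem entry_mem {x y : Q.Ob} {p : Str Q.Hom x y} {e : ℤ} (hp : Q.HasDeg p e) :
    p.entry ∈ Q.deg x y (e + 1 - p.length) := by
  cases hp with
  | nil => exact zero_mem _
  | cons hf hp =>
    cases hp with
    | nil => simpa [Str.entry, length] using hf
    | cons => exact zero_mem _

/-- Multilinear operations that agree on homogeneous strings are equal. -/
theorem IsMultilinear.ext {T T' : ∀ {x y : Q.Ob}, Str Q.Hom x y → M x y}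
    (hT : Q.IsMultilinear T) (hT' : Q.IsMultilinear T')
    (h : ∀ {x y : Q.Ob} (p : Str Q.Hom x y) (e : ℤ), Q.HasDeg p e → T p = T' p)
    {x y : Q.Ob} (p : Str Q.Hom x y) : T p = T' p := by
  -- By linearity, entries pass one at a time from the arbitrary string `p` to the homogeneous
  -- prefix `a`.
  suffices H : ∀ {x y : Q.Ob} (p : Str Q.Hom x y) {z : Q.Ob} (a : Str Q.Hom y z) (e : ℤ),
      Q.HasDeg a e → T (a.append p) = T' (a.append p) from H p nil 0 HasDeg.nil
  intro x y p
  induction p with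
  | nil => intro z a e ha; rw [append_nil]; exact h a e ha
  | cons f p ih =>
    intro z a e ha
    refine LinearMap.congr_fun (f := hT.slot a p) (g := hT'.slot a p) ?_ f
    refine linearMap_ext fun d g hg => ?_
    have := ih (a.append (Str.single g)) _ (ha.append (HasDeg.single hg))
    rwa [append_assoc] at this

/-- Koszul rule: in reduced degrees `T` has degree `t`, so the sign of its value differs from the
product of the signs of the entries by `(-1)^t`. It is used with `t = 0` for formal morphisms and `t
= 1` for A-infinity operations. -/
theorem map_sgnStr_of_mem {Q' : GradedQuiver.{w, u, v} R} {o : Q.Ob → Q'.Ob}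
    {T : ∀ {x y : Q.Ob}, Str Q.Hom x y → Q'.Hom (o x) (o y)}
    (hT : Q.IsMultilinear (M := fun x y => Q'.Hom (o x) (o y)) T) {t : ℤ}
    (hdeg : ∀ {x y : Q.Ob} (p : Str Q.Hom x y) (e : ℤ), Q.HasDeg p e →
      T p ∈ Q'.deg (o x) (o y) (e + 1 + t - p.length)) {x y : Q.Ob} (p : Str Q.Hom x y) :
    T (Q.sgnStr p) = ((Int.negOnePow t : ℤˣ) : ℤ) • Q'.sgn (T p) := by
  refine hT.sgnStr.ext (M := fun x y => Q'.Hom (o x) (o y))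
    (T' := fun {x y} p => ((Int.negOnePow t : ℤˣ) : ℤ) • Q'.sgn (T p))
    (hT.comp fun x y => ((Int.negOnePow t : ℤˣ) : ℤ) • Q'.sgn) ?_ p
  intro x y p e hp
  rw [Q'.sgn_of_mem (hdeg p e hp), smul_smul, ← Units.val_mul, ← Int.negOnePow_add]
  -- The prefix `a` carries no signs, so that signs can be pulled out of one entry after another.
  have key : ∀ {x y : Q.Ob} {p : Str Q.Hom x y} {e : ℤ}, Q.HasDeg p e →
      ∀ {z : Q.Ob} (a : Str Q.Hom y z), T (a.append (Q.sgnStr p)) =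
        ((Int.negOnePow (e - p.length) : ℤˣ) : ℤ) • T (a.append p) := by
    intro x y p e hp
    induction hp with
    | nil => intro z a; simp [sgnStr_nil, length]
    | @cons y z f p d e hf hp ih =>
      intro z a
      have h₁ := ih (a.append (Str.single (Q.sgn f)))
      simp only [append_assoc] at h₁
      change T (a.append (Str.cons (Q.sgn f) (Q.sgnStr p))) = _ at h₁
      rw [sgnStr_cons, h₁]
      change _ • hT.slot a p (Q.sgn f) = _ • hT.slot a p f
      rw [Q.sgn_of_mem hf, map_zsmul, smul_smul, ← Units.val_mul, ← Int.negOnePow_add]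
      congr 3
      simp only [length]; push_cast; ring
  have := key hp nil
  simp only [Str.append] at this
  rw [this]
  congr 2
  rw [Int.negOnePow_eq_iff]
  exact ⟨-t, by ring⟩

end Multilinear

/-! #### Insertion sums -/

section Insert

variable {M : Q.Ob → Q.Ob → Type*} [∀ x y, AddCommGroup (M x y)]
  {D : ∀ {x y : Q.Ob}, Str Q.Hom x y → Q.Hom x y} {T : ∀ {x y : Q.Ob}, Str Q.Hom x y → M x y}

theorem insertSum_eq {x z : Q.Ob} (p : Str Q.Hom x z) :
    Q.insertSum D T p = sumSplits p fun _ r c => sumSplits r fun _ a b =>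
      T (a.append (.cons (D b) (Q.sgnStr c))) := rfl

theorem insertSum_append_cons {x y y' z : Q.Ob} (p : Str Q.Hom y' z) (u : Q.Hom y y')
    (q : Str Q.Hom x y) :
    Q.insertSum D T (p.append (.cons u q)) =
      (sumSplits p fun _ r c => sumSplits r fun _ a b =>
        T (a.append (.cons (D b) ((Q.sgnStr c).append (.cons (Q.sgn u) (Q.sgnStr q)))))) +
      ((sumSplits p fun _ a b => sumSplits q fun _ b' c =>
        T (a.append (.cons (D (b.append (.cons u b'))) (Q.sgnStr c)))) +
      sumSplits q fun _ r c => sumSplits r fun _ a b =>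
        T (p.append (.cons u (a.append (.cons (D b) (Q.sgnStr c)))))) := by
  rw [insertSum_eq]
  simp only [sumSplits_append_cons, sgnStr_append, sgnStr_cons, append_assoc, Str.append,
    sumSplits_add]
  rw [sumSplits_comm q p]

/-- After an insertion the string has length at least one, and it has length one only if `D` has
absorbed all of `p`. This isolates the linear component of `T`, the only place where `D p` itself
occurs. -/
theorem insertSum_eq_high {x z : Q.Ob} (p : Str Q.Hom x z) :
    Q.insertSum D T p = T (.single (D p)) + Q.insertSum D (Str.high T) p := by
  simp only [insertSum_eq]
  have h : ∀ {x y : Q.Ob} (p : Str Q.Hom x y),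
      T p = (if p.length < 2 then T p else 0) + Str.high T p := by
    intro x y p; simp only [Str.high]; split_ifs <;> simp
  rw [sumSplits_congr fun s r c _ => sumSplits_congr fun t a b _ => h _]
  simp only [sumSplits_add]
  congr 1
  rw [sumSplits_of_left, sumSplits_of_right]
  · simp [Str.append, sgnStr_nil, length, Str.single]
  · intro y a b _ ha
    rw [if_neg]
    simp only [length_append_cons]; omega
  · intro y a b _ hb
    refine sumSplits_eq_zero fun s c d _ => ?_
    rw [if_neg]
    simp only [length_append_cons, length_sgnStr]; omega

/-- This makes the recursion for the operations well founded: a window of full length leaves a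
string of length one, which `Str.high` discards. -/
theorem insertSum_high_congr {D' : ∀ {x y : Q.Ob}, Str Q.Hom x y → Q.Hom x y} {x z : Q.Ob}
    {p : Str Q.Hom x z}
    (h : ∀ {x y : Q.Ob} (q : Str Q.Hom x y), q.length < p.length → D q = D' q) :
    Q.insertSum D (Str.high T) p = Q.insertSum D' (Str.high T) p := by
  simp only [insertSum_eq]
  refine sumSplits_congr fun s r c hr => sumSplits_congr fun t a b ha => ?_
  by_cases hb : b.length < p.length
  · rw [h b hb]
  · simp only [Str.high, length_append_cons, length_sgnStr]
    rw [if_pos (by omega), if_pos (by omega)]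

variable [∀ x y, Module R (M x y)]

theorem exists_linear_sumSplits {N F : Type*} [AddCommGroup N] [Module R N] [AddCommGroup F]
    [Module R F] {x z : Q.Ob} (p : Str Q.Hom x z) {W : F → ∀ y, Str Q.Hom y z → Str Q.Hom x y → N}
    (h : ∀ y (a : Str Q.Hom y z) (b : Str Q.Hom x y), ∃ φ : F →ₗ[R] N, ∀ f, W f y a b = φ f) :
    ∃ φ : F →ₗ[R] N, ∀ f, sumSplits p (W f) = φ f := by
  choose φ hφ using h
  refine ⟨sumSplits p φ, fun f => ?_⟩
  rw [← LinearMap.applyₗ_apply_apply f, map_sumSplits]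
  simp only [LinearMap.applyₗ_apply_apply, ← hφ]

theorem insertSum_multilinear (hD : Q.IsMultilinear D) (hT : Q.IsMultilinear T) :
    Q.IsMultilinear (Q.insertSum D T) := by
  refine IsMultilinear.of_linear fun {x y y' z} p q => ?_
  obtain ⟨φ₁, h₁⟩ := exists_linear_sumSplits (R := R) (F := Q.Hom y y') p
    (W := fun u _ r c => sumSplits r fun _ a b =>
        T (a.append (.cons (D b) ((Q.sgnStr c).append (.cons (Q.sgn u) (Q.sgnStr q))))))
    fun s r c => exists_linear_sumSplits r fun t a b =>
      ⟨hT.slot (a.append (.cons (D b) (Q.sgnStr c))) (Q.sgnStr q) ∘ₗ Q.sgn, fun f => by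
        simp [IsMultilinear.slot_apply, append_assoc, Str.append]⟩
  obtain ⟨φ₂, h₂⟩ := exists_linear_sumSplits (R := R) (F := Q.Hom y y') p
    (W := fun u _ a b => sumSplits q fun _ b' c =>
        T (a.append (.cons (D (b.append (.cons u b'))) (Q.sgnStr c))))
    fun s r c => exists_linear_sumSplits q fun t a b =>
      ⟨hT.slot r (Q.sgnStr b) ∘ₗ hD.slot c a, fun f => rfl⟩
  obtain ⟨φ₃, h₃⟩ := exists_linear_sumSplits (R := R) (F := Q.Hom y y') q
    (W := fun u _ r c => sumSplits r fun _ a b =>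
        T (p.append (.cons u (a.append (.cons (D b) (Q.sgnStr c))))))
    fun s r c => exists_linear_sumSplits r fun t a b => ⟨hT.slot p _, fun f => rfl⟩
  exact ⟨φ₁ + (φ₂ + φ₃), fun f => by
    simp only [insertSum_append_cons, h₁, h₂, h₃, LinearMap.add_apply]⟩

theorem insertSum_mem {S : ∀ x y, ℤ → Submodule R (M x y)} {t : ℤ}
    (hD : ∀ {x y : Q.Ob} (p : Str Q.Hom x y) (e : ℤ), Q.HasDeg p e →
      D p ∈ Q.deg x y (e + 2 - p.length))
    (hT : ∀ {x y : Q.Ob} (p : Str Q.Hom x y) (e : ℤ), Q.HasDeg p e →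
      T p ∈ S x y (e + t - p.length))
    {x y : Q.Ob} {p : Str Q.Hom x y} {e : ℤ} (hp : Q.HasDeg p e) :
    Q.insertSum D T p ∈ S x y (e + (t + 1) - p.length) := by
  rw [insertSum_eq]
  refine sumSplits_mem hp fun s r c d d' hr hc hd hl => ?_
  refine sumSplits_mem hr fun s a b d₁ d₂ ha hb hd' hl' => ?_
  have := hT _ _ (ha.append (HasDeg.cons (hD b _ hb) hc.sgnStr))
  convert this using 2
  rw [length_append_cons, length_sgnStr, ← hl, ← hl', ← hd, ← hd']
  push_cast; ring

/-- Inserting twice: the two insertions at disjoint places cancel. -/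
theorem insertSum_insertSum (hT : Q.IsMultilinear T)
    (hD : ∀ {x y : Q.Ob} (p : Str Q.Hom x y), D (Q.sgnStr p) = - Q.sgn (D p))
    {x z : Q.Ob} {p : Str Q.Hom x z}
    (h : ∀ {x y : Q.Ob} (q : Str Q.Hom x y), q.length < p.length → Q.insertSum D D q = 0) :
    Q.insertSum D (Q.insertSum D T) p = T (.single (Q.insertSum D D p)) := by
  have key : Q.insertSum D (Q.insertSum D T) p =
      sumSplits p fun _ r c => sumSplits r fun _ a b =>
        T (a.append (.cons (Q.insertSum D D b) c)) := by
    rw [insertSum_eq]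
    simp only [insertSum_append_cons, sumSplits_add, sgnStr_sgnStr]
    rw [← add_assoc, add_right_comm]
    refine Eq.trans (congrArg₂ (· + ·) (?_ : (_ : M x z) = 0) ?_) (zero_add _)
    -- Disjoint insertions: for two given windows, one order puts `sgn` on the value `D b` of the
    -- right window, the other applies `D` to `sgnStr b`. These differ by the sign in `hD`.
    · rw [add_eq_zero_iff_eq_neg]
      have e₁ : ∀ {x y y' z z' : Q.Ob} (a₀ : Str Q.Hom z' z) (b₀ : Q.Hom y' z')
          (a : Str Q.Hom y y') {t : Q.Ob} (b : Str Q.Hom t y) (c : Str Q.Hom x t),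
          T (a₀.append (.cons b₀ (a.append (.cons (D (Q.sgnStr b)) c)))) =
          - T (a₀.append (.cons b₀ (a.append (.cons (Q.sgn (D b)) c)))) := by
        intro x y y' z z' a₀ b₀ a t b c
        have := (hT.slot (a₀.append (.cons b₀ a)) c).map_neg (Q.sgn (D b))
        simp only [IsMultilinear.slot_apply, append_assoc, Str.append] at this
        rw [hD, this]
      simp only [sumSplits_sgnStr, sgnStr_sgnStr, e₁]
      rw [sumSplits_five' p fun _ _ _ _ a₀ b₀ a b c =>
        -T (a₀.append (.cons (D b₀) ((Q.sgnStr a).append (.cons (Q.sgn (D b)) c))))]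
      simp only [← sumSplits_neg, neg_neg]
    -- Nested insertions, collected by the outer window. The signs to the right of this window are
    -- applied twice and disappear.
    · simp only [sumSplits_sgnStr, sgnStr_sgnStr]
      rw [sumSplits_five p fun _ _ _ _ a₁ a₂ b c₁ c₂ =>
        T (a₁.append (.cons (D (a₂.append (.cons (D b) (Q.sgnStr c₁)))) c₂))]
      refine sumSplits_congr fun s r c _ => sumSplits_congr fun t a b _ => ?_
      rw [insertSum_eq, ← hT.slot_apply]
      simp only [map_sumSplits]
      rfl
  -- Windows shorter than `p` contribute zero by `h`, so only the full window is left.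
  rw [key, sumSplits_of_left, sumSplits_of_right]
  · rfl
  · intro y a b hab ha
    rw [h b (by omega)]
    exact (hT.slot a nil).map_zero
  · intro y a b hab hb
    refine sumSplits_eq_zero fun s c d hcd => ?_
    rw [h d (by omega)]
    exact (hT.slot c b).map_zero

end Insert

end GradedQuiver

end AInf

/-! ### Formal morphisms: composition and interaction with insertions. -/

namespace AInf

open Str

variable {R : Type w} [CommRing R]

namespace FormalMor

variable {Q₁ Q₂ Q₃ Q₄ : GradedQuiver.{w, u, v} R}

/-- The values live in modules indexed by `F.obj` and `G.obj`, which need only be propositionally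
equal; for the pullback square this is the equation `F x = G y`. -/
theorem ext_heq {F G : FormalMor Q₁ Q₂} (h : ∀ x, F.obj x = G.obj x)
    (h' : ∀ {x y : Q₁.Ob} (p : Str Q₁.Hom x y), F.map p ≍ G.map p) : F = G := by
  obtain ⟨o, φ, _, _, _⟩ := F
  obtain ⟨o', φ', _, _, _⟩ := G
  obtain rfl : o = o' := funext h
  congr
  funext x y p
  exact eq_of_heq (h' p)

theorem blockSum_eq (F : FormalMor Q₁ Q₂) {M : Q₂.Ob → Q₂.Ob → Type*}
    [∀ x y, AddCommGroup (M x y)] (T : ∀ {x y : Q₂.Ob}, Str Q₂.Hom x y → M x y) {x y : Q₁.Ob}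
    (p : Str Q₁.Hom x y) : F.blockSum T p = sumCuts p fun B => T (B.map F.obj F.map) := rfl

theorem comp_map (G : FormalMor Q₂ Q₃) (F : FormalMor Q₁ Q₂) {x y : Q₁.Ob}
    (p : Str Q₁.Hom x y) : (G.comp F).map p =
      F.blockSum (M := fun x y => Q₃.Hom (G.obj x) (G.obj y)) G.map p := rfl

theorem map_sgnStr (F : FormalMor Q₁ Q₂) {x y : Q₁.Ob} (p : Str Q₁.Hom x y) :
    F.map (Q₁.sgnStr p) = Q₂.sgn (F.map p) := by
  have := GradedQuiver.map_sgnStr_of_mem F.multilinear (t := 0)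
    (fun p e hp => by simpa using F.map_mem p e hp) p
  simpa using this

theorem map_blocks_sgnStr (F : FormalMor Q₁ Q₂) {x y : Q₁.Ob} (B : Str (Str Q₁.Hom) x y) :
    (B.map (fun z => z) fun b => Q₁.sgnStr b).map F.obj F.map = Q₂.sgnStr (B.map F.obj F.map) := by
  induction B with
  | nil => rfl
  | cons b B ih =>
    change cons (F.map (Q₁.sgnStr b)) _ = cons _ _
    rw [map_sgnStr]
    exact congrArg _ ih

theorem sumCuts_sgnStr {N : Type*} [AddCommMonoid N] {x z : Q₁.Ob} (p : Str Q₁.Hom x z)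
    (W : Str (Str Q₁.Hom) x z → N) :
    sumCuts (Q₁.sgnStr p) W = sumCuts p fun B => W (B.map (fun z => z) fun b => Q₁.sgnStr b) :=
  sumCuts_map (fun z => z) (fun f => Q₁.sgn f) p W

section

variable {M : Q₂.Ob → Q₂.Ob → Type*} [∀ x y, AddCommGroup (M x y)]
  {T : ∀ {x y : Q₂.Ob}, Str Q₂.Hom x y → M x y}

theorem blockSum_nil (F : FormalMor Q₁ Q₂) (x : Q₁.Ob) :
    F.blockSum T (nil : Str Q₁.Hom x x) = T nil := by
  rw [blockSum_eq, sumCuts_nil]; rfl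

theorem blockSum_high_nil (F : FormalMor Q₁ Q₂) (x : Q₁.Ob) :
    F.blockSum (Str.high T) (nil : Str Q₁.Hom x x) = 0 := by
  rw [blockSum_nil]; simp [Str.high, length]

/-- The only cut into a single block is the string itself. The empty string is excluded because its
only cut has no block at all and contributes `T nil`. -/
theorem blockSum_eq_high (F : FormalMor Q₁ Q₂) {x y : Q₁.Ob} {p : Str Q₁.Hom x y}
    (hp : p.length ≠ 0) :
    F.blockSum T p = T (.single (F.map p)) + F.blockSum (Str.high T) p := by
  simp only [blockSum_eq]
  have h : ∀ {x y : Q₂.Ob} (p : Str Q₂.Hom x y),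
      T p = (if p.length < 2 then T p else 0) + Str.high T p := by
    intro x y p; simp only [Str.high]; split_ifs <;> simp
  rw [show (fun B : Str (Str Q₁.Hom) x y => T (B.map F.obj F.map)) = _ from funext fun B => h _,
    sumCuts_add, sumCuts_of_length hp]
  · rfl
  · intro B hB
    rw [if_neg]
    rw [length_map]; omega

theorem blockSum_mem (F : FormalMor Q₁ Q₂) [∀ x y, Module R (M x y)]
    {S : ∀ x y, ℤ → Submodule R (M x y)} {t : ℤ}
    (hT : ∀ {x y : Q₂.Ob} (p : Str Q₂.Hom x y) (e : ℤ), Q₂.HasDeg p e →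
      T p ∈ S x y (e + t - p.length))
    {x y : Q₁.Ob} {p : Str Q₁.Hom x y} {e : ℤ} (hp : Q₁.HasDeg p e) :
    F.blockSum T p ∈ S (F.obj x) (F.obj y) (e + t - p.length) := by
  refine list_sum_mem fun s hs => ?_
  obtain ⟨B, hB, rfl⟩ := List.mem_map.1 hs
  have := hT _ _ (F.hasDeg_map hp B hB)
  rw [length_map] at this
  convert this using 2
  ring

variable [∀ x y, Module R (M x y)]

/-- The value of `blockSum` at a string with a marked entry, if the components of `F` of order at
least two vanish on strings with this entry. -/
theorem blockSum_append_cons (F : FormalMor Q₁ Q₂) {y y' : Q₁.Ob} {u : Q₁.Hom y y'}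
    (hu : ∀ {x z : Q₁.Ob} (p : Str Q₁.Hom y' z) (q : Str Q₁.Hom x y),
      (p.append (.cons u q)).length ≠ 1 → F.map (p.append (.cons u q)) = 0)
    (hT : Q₂.IsMultilinear T) {x z : Q₁.Ob} (p : Str Q₁.Hom y' z) (q : Str Q₁.Hom x y) :
    F.blockSum T (p.append (.cons u q)) = sumCuts p fun A => sumCuts q fun C =>
      T ((A.map F.obj F.map).append (.cons (F.map₁ u) (C.map F.obj F.map))) := by
  have h : ∀ {t s : Q₁.Ob} (a : Str Q₁.Hom y' t) (b : Str Q₁.Hom s y) (A : Str (Str Q₁.Hom) t z)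
      (C : Str (Str Q₁.Hom) x s), a.length + b.length ≠ 0 →
      T ((A.append (cons (a.append (cons u b)) C)).map F.obj F.map) = 0 := by
    intro t s a b A C hab
    rw [Str.map_append, Str.map, hu a b (by rw [length_append_cons]; omega)]
    exact (hT.slot _ _).map_zero
  rw [blockSum_eq, sumCuts_append_cons, sumSplits_of_left]
  · congr 1
    funext A
    rw [sumSplits_of_right]
    · simp only [Str.append, Str.map_append, Str.map]; rfl
    · intro s b c _ hb
      rw [← sumCuts_zero (M := M (F.obj x) (F.obj z)) c]
      congr 1
      funext C
      exact h _ _ _ _ (by omega)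
  · intro t a b _ hb
    rw [← sumCuts_zero (M := M (F.obj x) (F.obj z)) a]
    congr 1
    funext A
    refine sumSplits_eq_zero fun s b' c _ => ?_
    rw [← sumCuts_zero (M := M (F.obj x) (F.obj z)) c]
    congr 1
    funext C
    exact h _ _ _ _ (by omega)

end

/-! #### Associativity of composition -/

/-- Cutting into blocks and then grouping the blocks amounts to cutting into large blocks and
subdividing each of them. The induction removes the first large block; additivity of `W` moves the
sum over its subdivisions outside. -/
theorem sumCuts_sumCuts (G : FormalMor Q₂ Q₃) (F : FormalMor Q₁ Q₂) {N : Type*} [AddCommGroup N]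
    {x z : Q₁.Ob} (p : Str Q₁.Hom x z)
    (W : Str Q₃.Hom (G.obj (F.obj x)) (G.obj (F.obj z)) → N)
    (hW : ∀ {s t} (a : Str Q₃.Hom t (G.obj (F.obj z))) (f g : Q₃.Hom s t)
      (b : Str Q₃.Hom (G.obj (F.obj x)) s),
      W (a.append (cons (f + g) b)) = W (a.append (cons f b)) + W (a.append (cons g b))) :
    (sumCuts p fun B => sumCuts (B.map F.obj F.map) fun C => W (C.map G.obj G.map)) =
      sumCuts p fun B => W (B.map (G.comp F).obj (G.comp F).map) := by
  generalize hn : p.length = n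
  induction n using Nat.strong_induction_on generalizing z with
  | _ n ih =>
    cases p with
    | nil => simp only [sumCuts_nil, Str.map]; rfl
    | @cons y _ f p =>
      simp only [sumCuts_cons, Str.map, sumSplits_map, sumCuts_sumSplits]
      rw [← sumSplits_assoc p fun s t b d e => sumCuts d fun D => sumCuts e fun E =>
        sumCuts (E.map F.obj F.map) fun K =>
          W (cons (G.map (cons (F.map (cons f b)) (D.map F.obj F.map))) (K.map G.obj G.map))]
      refine sumSplits_congr fun s r e hr => ?_
      let Λ : Q₃.Hom (G.obj (F.obj s)) (G.obj (F.obj z)) →+ N :=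
        AddMonoidHom.mk' (fun h => sumCuts e fun E => W (cons h (E.map (G.comp F).obj (G.comp F).map)))
          fun h h' => by
            rw [← sumCuts_add]
            congr 1
            funext E
            exact hW nil h h' _
      change _ = Λ ((G.comp F).map (cons f r))
      rw [comp_map, blockSum_eq, sumCuts_cons, map_sumSplits]
      refine sumSplits_congr fun t b d hb => ?_
      rw [map_sumCuts]
      congr 1
      funext D
      refine ih e.length ?_ e
        (fun K => W (cons (G.map (cons (F.map (cons f b)) (D.map F.obj F.map))) K))
        (fun a => hW (cons (G.map (cons (F.map (cons f b)) (D.map F.obj F.map))) a)) rfl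
      simp only [length] at hn; omega

theorem blockSum_blockSum (G : FormalMor Q₂ Q₃) (F : FormalMor Q₁ Q₂) {M : Q₃.Ob → Q₃.Ob → Type*}
    [∀ x y, AddCommGroup (M x y)] [∀ x y, Module R (M x y)]
    {T : ∀ {x y : Q₃.Ob}, Str Q₃.Hom x y → M x y} (hT : Q₃.IsMultilinear T) {x y : Q₁.Ob}
    (p : Str Q₁.Hom x y) :
    F.blockSum (M := fun x y => M (G.obj x) (G.obj y)) (G.blockSum T) p = (G.comp F).blockSum T p :=
  sumCuts_sumCuts G F p (fun q => T q) fun a f g b => hT.add a f g b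

theorem comp_assoc (H : FormalMor Q₃ Q₄) (G : FormalMor Q₂ Q₃) (F : FormalMor Q₁ Q₂) :
    (H.comp G).comp F = H.comp (G.comp F) :=
  ext_heq (fun _ => rfl) fun p => heq_of_eq
    (blockSum_blockSum G F (M := fun x y => Q₄.Hom (H.obj x) (H.obj y)) H.multilinear p)

/-! #### Insertion sums and formal morphisms -/

section Insert

variable {M : Q₂.Ob → Q₂.Ob → Type*} [∀ x y, AddCommGroup (M x y)] [∀ x y, Module R (M x y)]
  {T : ∀ {x y : Q₂.Ob}, Str Q₂.Hom x y → M x y}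

/-- The block containing the inserted `D b` has the form `(a₂, D b, c₁)`. Collecting terms by the
stretch `a₂ b c₁` of the original string turns this block into an insertion sum for `F.map`, with
independent cuts on either side. -/
theorem insertSum_blockSum_expand (F : FormalMor Q₁ Q₂) (hT : Q₂.IsMultilinear T)
    (D : ∀ {x y : Q₁.Ob}, Str Q₁.Hom x y → Q₁.Hom x y) {x z : Q₁.Ob} (p : Str Q₁.Hom x z) :
    Q₁.insertSum (M := fun x y => M (F.obj x) (F.obj y)) D (F.blockSum T) p =
      sumSplits p fun _ r c => sumSplits r fun _ a b => sumCuts a fun A => sumCuts c fun C =>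
        T ((A.map F.obj F.map).append
          (.cons (Q₁.insertSum (M := fun x y => Q₂.Hom (F.obj x) (F.obj y)) D F.map b)
            (Q₂.sgnStr (C.map F.obj F.map)))) := by
  have e : ∀ {y y' : Q₁.Ob} (b : Str Q₁.Hom y y') (A : Str Q₂.Hom (F.obj y') (F.obj z))
      (C : Str Q₂.Hom (F.obj x) (F.obj y)),
      T (A.append (.cons (Q₁.insertSum (M := fun x y => Q₂.Hom (F.obj x) (F.obj y)) D F.map b) C)) =
        sumSplits b fun _ r c => sumSplits r fun _ a b => T (A.append
          (.cons (F.map (a.append (.cons (D b) (Q₁.sgnStr c)))) C)) := by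
    intro y y' b A C
    rw [← hT.slot_apply, GradedQuiver.insertSum_eq, map_sumSplits]
    exact sumSplits_congr fun _ _ _ _ => map_sumSplits _ _ _
  rw [GradedQuiver.insertSum_eq]
  simp only [blockSum_eq, sumCuts_append_cons, GradedQuiver.sumSplits_sgnStr,
    sumCuts_sgnStr, e, sumCuts_sumSplits_comm, Str.map_append, Str.map, map_blocks_sgnStr]
  exact sumSplits_five p fun s t s' t' a₁ a₂ b c₁ c₂ => sumCuts a₁ fun A => sumCuts c₂ fun C =>
    T ((A.map F.obj F.map).append (.cons (F.map (a₂.append (.cons (D b) (Q₁.sgnStr c₁))))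
      (Q₂.sgnStr (C.map F.obj F.map))))

/-- Here the terms are collected by the stretch of the string whose blocks are fed to `D`; the sum
over the cuts of this stretch is `F.blockSum D`. -/
theorem blockSum_insertSum_expand (F : FormalMor Q₁ Q₂) (hT : Q₂.IsMultilinear T)
    (D : ∀ {x y : Q₂.Ob}, Str Q₂.Hom x y → Q₂.Hom x y) {x z : Q₁.Ob} (p : Str Q₁.Hom x z) :
    F.blockSum (Q₂.insertSum D T) p =
      sumSplits p fun _ r c => sumSplits r fun _ a b => sumCuts a fun A => sumCuts c fun C =>
        T ((A.map F.obj F.map).append (.cons (F.blockSum D b)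
            (Q₂.sgnStr (C.map F.obj F.map)))) := by
  have e : ∀ {y y' : Q₁.Ob} (b : Str Q₁.Hom y y') (A : Str Q₂.Hom (F.obj y') (F.obj z))
      (C : Str Q₂.Hom (F.obj x) (F.obj y)),
      T (A.append (.cons (F.blockSum D b) C)) =
        sumCuts b fun B => T (A.append (.cons (D (B.map F.obj F.map)) C)) := by
    intro y y' b A C
    rw [← hT.slot_apply, blockSum_eq, map_sumCuts]
    rfl
  simp only [blockSum_eq, GradedQuiver.insertSum_eq, sumSplits_map, sumCuts_sumSplits]
  refine sumSplits_congr fun s r c _ => ?_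
  rw [sumCuts_comm]
  simp only [sumCuts_sumSplits, sumCuts_sumSplits_comm]
  refine sumSplits_congr fun t a b _ => ?_
  simp only [← blockSum_eq, e]
  rw [sumCuts_comm a c]

/-- If `F` is compatible with operations `D₁` and `D₂` on strings shorter than `p`, then it is
compatible with the insertion of `D₁` and `D₂` in `p`, up to its defect at `p`. -/
theorem insertSum_blockSum (F : FormalMor Q₁ Q₂) (hT : Q₂.IsMultilinear T)
    {D₁ : ∀ {x y : Q₁.Ob}, Str Q₁.Hom x y → Q₁.Hom x y}
    {D₂ : ∀ {x y : Q₂.Ob}, Str Q₂.Hom x y → Q₂.Hom x y} {x z : Q₁.Ob} {p : Str Q₁.Hom x z}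
    (h : ∀ {x y : Q₁.Ob} (q : Str Q₁.Hom x y), q.length < p.length → F.blockSum D₂ q =
      Q₁.insertSum (M := fun x y => Q₂.Hom (F.obj x) (F.obj y)) D₁ F.map q) :
    F.blockSum (Q₂.insertSum D₂ T) p +
      T (.single (Q₁.insertSum (M := fun x y => Q₂.Hom (F.obj x) (F.obj y)) D₁ F.map p -
        F.blockSum D₂ p)) =
      Q₁.insertSum (M := fun x y => M (F.obj x) (F.obj y)) D₁ (F.blockSum T) p := by
  rw [insertSum_blockSum_expand F hT, blockSum_insertSum_expand F hT, add_comm, ← eq_sub_iff_add_eq,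
    sub_eq_add_neg (sumSplits p _), sumSplits_neg, ← sumSplits_add]
  have e : ∀ {s t : Q₁.Ob} (r : Str Q₁.Hom s z) (c : Str Q₁.Hom x s) (a : Str Q₁.Hom t z)
      (b : Str Q₁.Hom s t), (sumCuts a fun A => sumCuts c fun C =>
        T ((A.map F.obj F.map).append
          (.cons (Q₁.insertSum (M := fun x y => Q₂.Hom (F.obj x) (F.obj y)) D₁ F.map b)
            (Q₂.sgnStr (C.map F.obj F.map))))) = (sumCuts a fun A => sumCuts c fun C =>
        T ((A.map F.obj F.map).append (.cons (F.blockSum D₂ b)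
            (Q₂.sgnStr (C.map F.obj F.map))))) + (sumCuts a fun A => sumCuts c fun C =>
        T ((A.map F.obj F.map).append (.cons
          (Q₁.insertSum (M := fun x y => Q₂.Hom (F.obj x) (F.obj y)) D₁ F.map b - F.blockSum D₂ b)
            (Q₂.sgnStr (C.map F.obj F.map))))) := by
    intro s t r c a b
    simp only [← sumCuts_add, ← hT.add, add_sub_cancel]
  have h0 : ∀ {s t : Q₁.Ob} (c : Str Q₁.Hom x s) (a : Str Q₁.Hom t z)
      (b : Str Q₁.Hom s t), b.length < p.length → (sumCuts a fun A => sumCuts c fun C =>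
        T ((A.map F.obj F.map).append (.cons
          (Q₁.insertSum (M := fun x y => Q₂.Hom (F.obj x) (F.obj y)) D₁ F.map b - F.blockSum D₂ b)
            (Q₂.sgnStr (C.map F.obj F.map))))) = 0 := by
    intro s t c a b hb
    rw [h b hb]
    simp only [sub_self, ← hT.slot_apply, map_zero, sumCuts_zero]
  simp only [sumSplits_neg, ← sumSplits_add]
  symm
  -- The two expansions differ by the defect of `F` on the window `b`, which vanishes unless `b` is
  -- all of `p`.
  rw [sumSplits_of_left, sumSplits_of_right]
  · rw [e p]
    simp only [sumCuts_nil, add_neg_cancel_comm]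
    rfl
  · intro t a b hab ha
    rw [e p, h0 _ _ _ (by omega)]; simp
  · intro s r c hr hc
    refine sumSplits_eq_zero fun t a b hab => ?_
    rw [e r, h0 _ _ _ (by omega)]; simp

end Insert

end FormalMor

end AInf

/-! ### Construction of graded operations, the pullback quiver and its projections. -/

namespace AInf

open Str

variable {R : Type w} [CommRing R]

namespace GradedQuiver

/-! #### Homogeneous components -/

/-- Injectivity holds because `π e` recovers the component of degree `e` of a formal sum; `h₄` gives
surjectivity. -/
theorem isInternal_of_proj {V : Type*} [AddCommGroup V] [Module R V] {𝒱 : ℤ → Submodule R V}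
    (π : ℤ → V →ₗ[R] V) (h₁ : ∀ d, ∀ v ∈ 𝒱 d, π d v = v) (h₂ : ∀ d e, d ≠ e → ∀ v ∈ 𝒱 d, π e v = 0)
    (h₃ : ∀ d v, π d v ∈ 𝒱 d) (h₄ : ∀ v, ∃ S : Finset ℤ, ∑ d ∈ S, π d v = v) :
    DirectSum.IsInternal 𝒱 := by
  constructor
  · have key : ∀ e, π e ∘ₗ DirectSum.coeLinearMap 𝒱 =
        (𝒱 e).subtype ∘ₗ DirectSum.component R ℤ (fun d => 𝒱 d) e := by
      intro e
      refine DirectSum.linearMap_ext R fun d => ?_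
      ext v
      simp only [LinearMap.comp_apply, DirectSum.coeLinearMap_lof]
      by_cases h : d = e
      · subst h
        rw [DirectSum.component.lof_self, h₁ d v v.2]; rfl
      · rw [h₂ d e h v v.2, DirectSum.component.of, dif_neg h]; rfl
    refine (injective_iff_map_eq_zero (DirectSum.coeAddMonoidHom 𝒱)).2 fun x hx => ?_
    ext e
    have := LinearMap.congr_fun (key e) x
    have hx' : DirectSum.coeLinearMap 𝒱 x = 0 := hx
    rw [LinearMap.comp_apply, hx', map_zero] at this
    exact this.symm
  · intro v
    obtain ⟨S, hS⟩ := h₄ v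
    refine ⟨∑ d ∈ S, DirectSum.of (fun d => 𝒱 d) d ⟨π d v, h₃ d v⟩, ?_⟩
    rw [map_sum]
    simpa using hS

variable (Q : GradedQuiver.{w, u, v} R)

/-- The projection to the homogeneous part of degree `d`. -/
noncomputable def proj (x y : Q.Ob) (d : ℤ) : Q.Hom x y →ₗ[R] Q.Hom x y :=
  (Q.deg x y d).subtype ∘ₗ DirectSum.component R ℤ (fun d => Q.deg x y d) d ∘ₗ
    (LinearEquiv.ofBijective (DirectSum.coeLinearMap (Q.deg x y)) (Q.isInternal x y)).symm

variable {Q} {x y : Q.Ob}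

theorem proj_mem (d : ℤ) (f : Q.Hom x y) : Q.proj x y d f ∈ Q.deg x y d :=
  Subtype.property _

theorem ofBijective_symm_of_mem {d : ℤ} {f : Q.Hom x y} (hf : f ∈ Q.deg x y d) :
    (LinearEquiv.ofBijective (DirectSum.coeLinearMap (Q.deg x y)) (Q.isInternal x y)).symm f
      = DirectSum.lof R ℤ (fun i => Q.deg x y i) d ⟨f, hf⟩ := by
  rw [LinearEquiv.symm_apply_eq]
  exact (DirectSum.coeLinearMap_lof (Q.deg x y) d ⟨f, hf⟩).symm

theorem proj_of_mem {d : ℤ} {f : Q.Hom x y} (hf : f ∈ Q.deg x y d) : Q.proj x y d f = f := by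
  simp only [proj, LinearMap.comp_apply, LinearEquiv.coe_coe, ofBijective_symm_of_mem hf,
    DirectSum.component.lof_self, Submodule.subtype_apply]

theorem proj_of_mem_of_ne {d e : ℤ} (h : d ≠ e) {f : Q.Hom x y} (hf : f ∈ Q.deg x y d) :
    Q.proj x y e f = 0 := by
  simp only [proj, LinearMap.comp_apply, LinearEquiv.coe_coe, ofBijective_symm_of_mem hf,
    DirectSum.component.of, dif_neg h, map_zero]

/-- Allowing every larger finite set lets one set of degrees serve several elements at once. -/
theorem exists_sum_proj (f : Q.Hom x y) :
    ∃ S : Finset ℤ, ∀ S' : Finset ℤ, S ⊆ S' → ∑ d ∈ S', Q.proj x y d f = f := by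
  have := span_homogeneous (Q := Q) (S :=
    { carrier := {f : Q.Hom x y | ∃ S : Finset ℤ, ∀ S' : Finset ℤ, S ⊆ S' →
        ∑ d ∈ S', Q.proj x y d f = f}
      add_mem' := by
        rintro f g ⟨S, hS⟩ ⟨S₁, hS₁⟩
        refine ⟨S ∪ S₁, fun S' h => ?_⟩
        simp only [map_add, Finset.sum_add_distrib]
        rw [hS S' (Finset.union_subset_left h), hS₁ S' (Finset.union_subset_right h)]
      zero_mem' := ⟨∅, fun S' _ => by simp⟩
      smul_mem' := by
        rintro r f ⟨S, hS⟩
        refine ⟨S, fun S' h => ?_⟩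
        simp only [map_smul, ← Finset.smul_sum]
        rw [hS S' h] }) (fun d g hg => ⟨{d}, fun S' h => by
          rw [Finset.sum_eq_single d, proj_of_mem hg]
          · exact fun e _ he => proj_of_mem_of_ne (Ne.symm he) hg
          · exact fun hd => absurd (h (Finset.mem_singleton_self d)) hd⟩) f
  exact this

theorem map_proj {Q' : GradedQuiver.{w, u, v} R} {x' y' : Q'.Ob} (φ : Q.Hom x y →ₗ[R] Q'.Hom x' y')
    (hφ : ∀ d, ∀ f ∈ Q.deg x y d, φ f ∈ Q'.deg x' y' d) (d : ℤ) (f : Q.Hom x y) :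
    φ (Q.proj x y d f) = Q'.proj x' y' d (φ f) := by
  have : φ ∘ₗ Q.proj x y d = Q'.proj x' y' d ∘ₗ φ := by
    refine linearMap_ext fun e f hf => ?_
    simp only [LinearMap.comp_apply]
    by_cases h : e = d
    · subst h
      rw [proj_of_mem hf, proj_of_mem (hφ _ f hf)]
    · rw [proj_of_mem_of_ne h hf, proj_of_mem_of_ne h (hφ _ f hf), map_zero]
  exact LinearMap.congr_fun this f

variable (Q) in
/-- Transport of morphisms along equalities of objects. -/
def castHom {x x' y y' : Q.Ob} (h : x = x') (h' : y = y') : Q.Hom x y →ₗ[R] Q.Hom x' y' := by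
  subst h h'
  exact LinearMap.id

theorem castHom_heq {x x' y y' : Q.Ob} (h : x = x') (h' : y = y') (f : Q.Hom x y) :
    Q.castHom h h' f ≍ f := by
  subst h h'
  rfl

theorem castHom_mem {x x' y y' : Q.Ob} (h : x = x') (h' : y = y') {f : Q.Hom x y} {d : ℤ}
    (hf : f ∈ Q.deg x y d) : Q.castHom h h' f ∈ Q.deg x' y' d := by
  subst h h'
  exact hf

/-! #### Operations defined by recursion on the length -/

/-- Each linearity identity compares strings of one and the same length, so agreement with a
multilinear family up to that length suffices. -/
theorem multilinear_of_locally {M : Q.Ob → Q.Ob → Type*} [∀ x y, AddCommGroup (M x y)]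
    [∀ x y, Module R (M x y)] {φ : ∀ x y : Q.Ob, Str Q.Hom x y → M x y}
    (h : ∀ n : ℕ, ∃ γ : ∀ x y : Q.Ob, Str Q.Hom x y → M x y,
      Q.IsMultilinear (M := M) (fun {x y} => γ x y) ∧
      ∀ x y (p : Str Q.Hom x y), p.length ≤ n → φ x y p = γ x y p) :
    Q.IsMultilinear (M := M) fun {x y} => φ x y where
  add p f g q := by
    obtain ⟨γ, hγ, hφ⟩ := h (p.length + q.length + 1)
    have := hγ.add p f g q
    simpa only [hφ _ _ _ (length_append_cons _ _ _).le] using this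
  smul p r f q := by
    obtain ⟨γ, hγ, hφ⟩ := h (p.length + q.length + 1)
    have := hγ.smul p r f q
    simpa only [hφ _ _ _ (length_append_cons _ _ _).le] using this

/-- `Q.IsOperation S t φ`: the family `φ` is multilinear and its component of order `n` has
degree `t - n`. -/
structure IsOperation {M : Q.Ob → Q.Ob → Type*} [∀ x y, AddCommGroup (M x y)]
    [∀ x y, Module R (M x y)] (S : ∀ x y, ℤ → Submodule R (M x y)) (t : ℤ)
    (φ : ∀ x y : Q.Ob, Str Q.Hom x y → M x y) : Prop where
  multilinear : Q.IsMultilinear (M := M) fun {x y} => φ x y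
  mem : ∀ {x y : Q.Ob} (p : Str Q.Hom x y) (e : ℤ), Q.HasDeg p e →
    φ x y p ∈ S x y (e + t - p.length)

/-- `good` carries extra information through the recursion, such as vanishing on empty strings,
which is needed to treat an intermediate `φ` as a formal morphism. -/
theorem exists_operation {M : Q.Ob → Q.Ob → Type*} [∀ x y, AddCommGroup (M x y)]
    [∀ x y, Module R (M x y)] (S : ∀ x y, ℤ → Submodule R (M x y)) (t : ℤ)
    (Φ : (∀ x y, Str Q.Hom x y → M x y) → ∀ x y, Str Q.Hom x y → M x y)
    (hΦ : ∀ (φ φ' : ∀ x y, Str Q.Hom x y → M x y) {x y : Q.Ob} (p : Str Q.Hom x y),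
      (∀ x y (q : Str Q.Hom x y), q.length < p.length → φ x y q = φ' x y q) → Φ φ x y p = Φ φ' x y p)
    (good : (∀ x y, Str Q.Hom x y → M x y) → Prop) (h₀ : good fun _ _ _ => 0)
    (h : ∀ φ, IsOperation S t φ → good φ → IsOperation S t (Φ φ) ∧ good (Φ φ)) :
    ∃ φ, IsOperation S t φ ∧ ∀ x y p, φ x y p = Φ φ x y p := by
  obtain ⟨φ, hφ, hγ⟩ := exists_fixedPoint Φ hΦ (fun φ => IsOperation S t φ ∧ good φ)
    (φ₀ := fun _ _ _ => 0) ⟨⟨IsMultilinear.zero, fun _ _ _ => zero_mem _⟩, h₀⟩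
    (fun φ hφ => h φ hφ.1 hφ.2)
  refine ⟨φ, ⟨multilinear_of_locally fun n => ?_, fun {x y} p e hp => ?_⟩, hφ⟩
  · obtain ⟨γ, h, h'⟩ := hγ n
    exact ⟨γ, h.1.multilinear, h'⟩
  · obtain ⟨γ, h, h'⟩ := hγ p.length
    rw [h' _ _ _ le_rfl]
    exact h.1.mem p e hp

end GradedQuiver

open GradedQuiver

/-! ### The pullback of graded quivers -/

namespace FormalMor

variable {Q₁ Q₂ : GradedQuiver.{w, u, v} R}

/-- The linear component of a formal morphism, as a linear map. -/
def lin (F : FormalMor Q₁ Q₂) (x y : Q₁.Ob) : Q₁.Hom x y →ₗ[R] Q₂.Hom (F.obj x) (F.obj y) :=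
  F.multilinear.slot nil nil

theorem lin_apply (F : FormalMor Q₁ Q₂) {x y : Q₁.Ob} (f : Q₁.Hom x y) :
    F.lin x y f = F.map (.single f) := rfl

theorem lin_mem (F : FormalMor Q₁ Q₂) {x y : Q₁.Ob} {f : Q₁.Hom x y} {d : ℤ}
    (hf : f ∈ Q₁.deg x y d) : F.lin x y f ∈ Q₂.deg (F.obj x) (F.obj y) d := by
  have := F.map_mem _ _ (HasDeg.single hf)
  rwa [show (Str.single f).length = 1 from rfl, Nat.cast_one, add_sub_cancel_right] at this

/-- A section of the linear component of a formal morphism by graded linear maps. -/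
structure LinSection (F : FormalMor Q₁ Q₂) where
  lift : ∀ x y : Q₁.Ob, Q₂.Hom (F.obj x) (F.obj y) →ₗ[R] Q₁.Hom x y
  lift_mem : ∀ {x y : Q₁.Ob} {d : ℤ} {g : Q₂.Hom (F.obj x) (F.obj y)},
    g ∈ Q₂.deg (F.obj x) (F.obj y) d → lift x y g ∈ Q₁.deg x y d
  lin_lift : ∀ {x y : Q₁.Ob} (g : Q₂.Hom (F.obj x) (F.obj y)), F.lin x y (lift x y g) = g

end FormalMor

namespace Pullback

variable {A A' A'' : GradedQuiver.{w, u, v} R} (F : FormalMor A A') (G : FormalMor A'' A')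

/-- The pairs `(x, y)` with `F x = G y`. -/
abbrev Ob : Type u := {p : A.Ob × A''.Ob // F.obj p.1 = G.obj p.2}

/-- The identification of `A'(G y, G y')` with `A'(F x, F x')` for objects `(x, y)`, `(x', y')` of
the pullback. -/
def ident (p q : Ob F G) : A'.Hom (G.obj p.1.2) (G.obj q.1.2) →ₗ[R] A'.Hom (F.obj p.1.1) (F.obj q.1.1) :=
  A'.castHom p.2.symm q.2.symm

/-- The map `(a, a'') ↦ G¹ a'' - F¹ a`. -/
def diff (p q : Ob F G) : A.Hom p.1.1 q.1.1 × A''.Hom p.1.2 q.1.2 →ₗ[R] A'.Hom (F.obj p.1.1) (F.obj q.1.1) :=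
  ident F G p q ∘ₗ G.lin _ _ ∘ₗ LinearMap.snd R _ _ - F.lin _ _ ∘ₗ LinearMap.fst R _ _

theorem diff_apply {p q : Ob F G} (a : A.Hom p.1.1 q.1.1) (a'' : A''.Hom p.1.2 q.1.2) :
    diff F G p q (a, a'') = ident F G p q (G.lin _ _ a'') - F.lin _ _ a := rfl

theorem ident_mem {p q : Ob F G} {d : ℤ} {g : A'.Hom (G.obj p.1.2) (G.obj q.1.2)}
    (hg : g ∈ A'.deg _ _ d) : ident F G p q g ∈ A'.deg _ _ d :=
  castHom_mem _ _ hg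

/-- `F¹`, `G¹` and the identification of objects preserve degrees, so the homogeneous components of
a pair in the kernel stay in the kernel. -/
theorem isInternal_ker_diff (p q : Ob F G) : DirectSum.IsInternal fun d =>
    ((A.deg p.1.1 q.1.1 d).prod (A''.deg p.1.2 q.1.2 d)).comap (LinearMap.ker (diff F G p q)).subtype := by
  have hker : ∀ d, ∀ v ∈ LinearMap.ker (diff F G p q),
      (A.proj p.1.1 q.1.1 d).prodMap (A''.proj p.1.2 q.1.2 d) v ∈ LinearMap.ker (diff F G p q) := by
    rintro d ⟨a, a''⟩ h
    rw [LinearMap.mem_ker, diff_apply] at h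
    rw [LinearMap.mem_ker, LinearMap.prodMap_apply, diff_apply,
      map_proj (F.lin _ _) (fun _ _ => F.lin_mem), map_proj (G.lin _ _) (fun _ _ => G.lin_mem),
      map_proj (ident F G p q) (fun _ _ => ident_mem F G), ← map_sub, h, map_zero]
  refine isInternal_of_proj (fun d => LinearMap.restrict _ (hker d)) ?_ ?_ ?_ ?_
  · rintro d ⟨⟨a, a''⟩, h⟩ hv
    exact Subtype.ext (Prod.ext (proj_of_mem hv.1) (proj_of_mem hv.2))
  · rintro d e hd ⟨⟨a, a''⟩, h⟩ hv
    exact Subtype.ext (Prod.ext (proj_of_mem_of_ne hd hv.1) (proj_of_mem_of_ne hd hv.2))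
  · rintro d ⟨⟨a, a''⟩, h⟩
    exact ⟨proj_mem d a, proj_mem d a''⟩
  · rintro ⟨⟨a, a''⟩, h⟩
    obtain ⟨S, hS⟩ := exists_sum_proj a
    obtain ⟨S', hS'⟩ := exists_sum_proj a''
    refine ⟨S ∪ S', Subtype.ext ?_⟩
    rw [AddSubmonoidClass.coe_finsetSum]
    refine Prod.ext ?_ ?_
    · rw [Prod.fst_sum]; exact hS _ Finset.subset_union_left
    · rw [Prod.snd_sum]; exact hS' _ Finset.subset_union_right

/-- The pullback quiver: the morphisms `(x, y) → (x', y')` are the pairs `(a, a'')` with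
`F¹ a = G¹ a''`. -/
abbrev quiver : GradedQuiver.{w, u, v} R where
  Ob := Ob F G
  Hom p q := LinearMap.ker (diff F G p q)
  deg p q d := ((A.deg p.1.1 q.1.1 d).prod (A''.deg p.1.2 q.1.2 d)).comap
    (LinearMap.ker (diff F G p q)).subtype
  isInternal p q := isInternal_ker_diff F G p q

/-- The projection `(a, a'') ↦ a`. -/
def fst (p q : (quiver F G).Ob) : (quiver F G).Hom p q →ₗ[R] A.Hom p.1.1 q.1.1 :=
  LinearMap.fst R _ _ ∘ₗ (LinearMap.ker (diff F G p q)).subtype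

/-- The projection `(a, a'') ↦ a''`. -/
def snd (p q : (quiver F G).Ob) : (quiver F G).Hom p q →ₗ[R] A''.Hom p.1.2 q.1.2 :=
  LinearMap.snd R _ _ ∘ₗ (LinearMap.ker (diff F G p q)).subtype

variable {F G}

theorem mem_deg_iff {p q : (quiver F G).Ob} {d : ℤ} {f : (quiver F G).Hom p q} :
    f ∈ (quiver F G).deg p q d ↔ fst F G p q f ∈ A.deg _ _ d ∧ snd F G p q f ∈ A''.deg _ _ d :=
  Iff.rfl

theorem hom_ext {p q : (quiver F G).Ob} {f g : (quiver F G).Hom p q}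
    (h₁ : fst F G p q f = fst F G p q g) (h₂ : snd F G p q f = snd F G p q g) : f = g :=
  Subtype.ext (Prod.ext h₁ h₂)

theorem ident_lin_snd {p q : (quiver F G).Ob} (f : (quiver F G).Hom p q) :
    ident F G p q (G.lin _ _ (snd F G p q f)) = F.lin _ _ (fst F G p q f) :=
  sub_eq_zero.1 f.2

theorem ident_heq {p q : Ob F G} (g : A'.Hom (G.obj p.1.2) (G.obj q.1.2)) : ident F G p q g ≍ g :=
  castHom_heq _ _ g

variable (s : F.LinSection)

/-- The retraction of `A × A''` to the morphisms of the pullback that is given by a section of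
`F¹`. -/
def retract (p q : (quiver F G).Ob) :
    A.Hom p.1.1 q.1.1 × A''.Hom p.1.2 q.1.2 →ₗ[R] (quiver F G).Hom p q :=
  LinearMap.codRestrict _ (LinearMap.prod (LinearMap.fst R _ _ + s.lift _ _ ∘ₗ diff F G p q)
    (LinearMap.snd R _ _)) <| by
      rintro ⟨a, a''⟩
      rw [LinearMap.mem_ker]
      change diff F G p q (a + s.lift _ _ (diff F G p q (a, a'')), a'') = 0
      rw [diff_apply, map_add, s.lin_lift, diff_apply]
      abel

theorem fst_retract {p q : (quiver F G).Ob} (a : A.Hom p.1.1 q.1.1) (a'' : A''.Hom p.1.2 q.1.2) :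
    fst F G p q (retract s p q (a, a'')) =
      a + s.lift _ _ (ident F G p q (G.lin _ _ a'') - F.lin _ _ a) := rfl

theorem retract_mem {p q : (quiver F G).Ob} {a : A.Hom p.1.1 q.1.1} {a'' : A''.Hom p.1.2 q.1.2}
    {d : ℤ} (ha : a ∈ A.deg _ _ d) (ha'' : a'' ∈ A''.deg _ _ d) :
    retract s p q (a, a'') ∈ (quiver F G).deg p q d :=
  mem_deg_iff.2 ⟨add_mem ha (s.lift_mem (sub_mem (ident_mem F G (G.lin_mem ha'')) (F.lin_mem ha))),
    ha''⟩

/-! #### The projections from the pullback -/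

variable (F G) in
/-- The projection to `A''`, which has only a linear component. -/
def toRight : FormalMor (quiver F G) A'' where
  obj p := p.1.2
  map p := snd F G _ _ p.entry
  map_nil _ := map_zero _
  multilinear := IsMultilinear.entry.comp fun x y => snd F G x y
  map_mem _ _ h := (mem_deg_iff.1 (entry_mem h)).2

theorem toRight_high {p q : (quiver F G).Ob} (a : Str (quiver F G).Hom p q) :
    Str.high (M := fun x y => A''.Hom ((toRight F G).obj x) ((toRight F G).obj y))
      (toRight F G).map a = 0 := by
  match a with
  | nil => rfl
  | cons _ nil => rfl
  | cons _ (cons _ _) => exact map_zero (snd F G _ _)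

/-- The recursion for the projection to `A`. -/
def leftStep (φ : ∀ p q : (quiver F G).Ob, Str (quiver F G).Hom p q → A.Hom p.1.1 q.1.1)
    (p q : (quiver F G).Ob) (a : Str (quiver F G).Hom p q) : A.Hom p.1.1 q.1.1 :=
  -- On strings of length one the argument of `s.lift` is `G¹ a'' - F¹ a = 0`, which leaves the
  -- projection. On longer strings the entry is zero and the formula solves `F · β = G · α` for the
  -- top component of `β`.
  fst F G p q a.entry + s.lift _ _ ((ident F G p q ((G.comp (toRight F G)).map a) -
    F.lin _ _ (fst F G p q a.entry)) - sumCuts a fun B =>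
      Str.high (M := fun x y => A'.Hom (F.obj x) (F.obj y)) F.map
        (B.map (fun p => p.1.1) fun {p q} => φ p q))

theorem leftStep_nil (φ : ∀ p q : (quiver F G).Ob, Str (quiver F G).Hom p q → A.Hom p.1.1 q.1.1)
    (p : (quiver F G).Ob) : leftStep s φ p p nil = 0 := by
  simp only [leftStep, sumCuts_nil, Str.entry, Str.map, Str.high, length, map_zero, sub_zero,
    zero_add, zero_lt_two, if_true]
  refine Eq.trans (congrArg (fun t => s.lift _ _ (ident F G p p t))
    ((G.comp (toRight F G)).map_nil p)) ?_
  exact (s.lift _ _ ∘ₗ ident F G p p).map_zero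

theorem exists_left : ∃ φ : ∀ p q : (quiver F G).Ob, Str (quiver F G).Hom p q → A.Hom p.1.1 q.1.1,
    IsOperation (Q := quiver F G) (M := fun p q => A.Hom p.1.1 q.1.1)
      (fun p q => A.deg p.1.1 q.1.1) 1 φ ∧
    ∀ p q a, φ p q a = leftStep s φ p q a := by
  refine exists_operation (Q := quiver F G) (M := fun p q => A.Hom p.1.1 q.1.1)
    (fun p q => A.deg p.1.1 q.1.1) 1 (leftStep s) ?_ (fun φ => ∀ p, φ p p nil = 0) (fun _ => rfl) ?_
  · intro φ φ' p q a h
    unfold leftStep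
    rw [sumCuts_map_congr_of_lt (W := Str.high (M := fun x y => A'.Hom (F.obj x) (F.obj y)) F.map)
      (fun b hb => h _ _ b hb) fun b hb => if_pos hb]
  · intro φ hφ h0
    -- Packaging `φ` as a formal morphism makes multilinearity and degrees of the sum over cuts
    -- available.
    let E : FormalMor (quiver F G) A := ⟨fun p => p.1.1, fun {p q} => φ p q, h0, hφ.multilinear,
      fun a e ha => hφ.mem a e ha⟩
    have hE : ∀ {p q : (quiver F G).Ob} (a : Str (quiver F G).Hom p q), leftStep s φ p q a =
      fst F G p q a.entry + s.lift _ _ ((ident F G p q ((G.comp (toRight F G)).map a) -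
    F.lin _ _ (fst F G p q a.entry)) - E.blockSum
      (Str.high (M := fun x y => A'.Hom (F.obj x) (F.obj y)) F.map) a) := fun a => rfl
    have h₁ : (quiver F G).IsMultilinear (M := fun p q => A.Hom p.1.1 q.1.1)
      fun {p q} a => fst F G p q a.entry := IsMultilinear.entry.comp fun x y => fst F G x y
    refine ⟨⟨?_, ?_⟩, ?_⟩
    · refine h₁.add' (IsMultilinear.comp (M := fun p q : (quiver F G).Ob => A'.Hom (F.obj p.1.1) (F.obj q.1.1))
        (IsMultilinear.sub (IsMultilinear.sub (IsMultilinear.comp (G.comp (toRight F G)).multilinear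
          fun p q : (quiver F G).Ob => ident F G p q)
          (h₁.comp fun p q : (quiver F G).Ob => F.lin p.1.1 q.1.1))
          (E.blockSum_linear (M := fun x y => A'.Hom (F.obj x) (F.obj y)) _ F.multilinear.high))
        fun p q : (quiver F G).Ob => s.lift p.1.1 q.1.1)
    · intro p q a e ha
      rw [hE]
      have h₂ := (mem_deg_iff.1 (entry_mem ha)).1
      refine add_mem h₂ (s.lift_mem (sub_mem (sub_mem (ident_mem F G ?_) (F.lin_mem h₂)) ?_))
      · exact (G.comp (toRight F G)).map_mem a e ha
      · refine E.blockSum_mem (M := fun x y => A'.Hom (F.obj x) (F.obj y))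
          (S := fun x y => A'.deg (F.obj x) (F.obj y)) ?_ ha
        intro x y p e hp
        unfold Str.high
        split_ifs
        · exact zero_mem _
        · exact F.map_mem p e hp
    · exact leftStep_nil s φ

/-- The projection to `A`. -/
noncomputable def toLeft : FormalMor (quiver F G) A where
  obj p := p.1.1
  map {p q} := (exists_left s).choose p q
  map_nil p := by
    rw [(exists_left s).choose_spec.2, leftStep_nil]
  multilinear := (exists_left s).choose_spec.1.multilinear
  map_mem a e ha := (exists_left s).choose_spec.1.mem a e ha

theorem toLeft_map {p q : (quiver F G).Ob} (a : Str (quiver F G).Hom p q) :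
    (toLeft s).map a = fst F G p q a.entry + s.lift _ _
      ((ident F G p q ((G.comp (toRight F G)).map a) - F.lin _ _ (fst F G p q a.entry)) -
        (show A'.Hom (F.obj p.1.1) (F.obj q.1.1) from (toLeft s).blockSum
          (Str.high (M := fun x y => A'.Hom (F.obj x) (F.obj y)) F.map) a)) :=
  (exists_left s).choose_spec.2 p q a

theorem comp_map_eq {Q₁ Q₂ Q₃ : GradedQuiver.{w, u, v} R} (G : FormalMor Q₂ Q₃)
    (F : FormalMor Q₁ Q₂) {x y : Q₁.Ob} (p : Str Q₁.Hom x y) :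
    (G.comp F).map p = G.lin _ _ (F.map p) +
      F.blockSum (Str.high (M := fun x y => Q₃.Hom (G.obj x) (G.obj y)) G.map) p := by
  cases p with
  | nil =>
    rw [F.map_nil, map_zero]
    refine ((G.comp F).map_nil x).trans (Eq.trans (add_zero _).symm (congrArg _ ?_))
    exact (F.blockSum_high_nil (M := fun x y => Q₃.Hom (G.obj x) (G.obj y)) x).symm
  | cons f p =>
    exact F.blockSum_eq_high (M := fun x y => Q₃.Hom (G.obj x) (G.obj y)) (p := cons f p)
      (by simp [length])

/-- Correcting `a` by the section solves `φ x + g' = g` exactly; applied with `φ = F¹`, this is the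
commutativity of the square in each order. -/
theorem _root_.LinearMap.map_add_lift_sub {V W : Type*} [AddCommGroup V] [AddCommGroup W]
    [Module R V] [Module R W] {φ : V →ₗ[R] W} {ψ : W →ₗ[R] V} (h : ∀ g, φ (ψ g) = g)
    (a : V) (g g' : W) : φ (a + ψ ((g - φ a) - g')) + g' = g := by
  rw [map_add, h]; abel

/-- The square commutes. -/
theorem comp_toLeft : F.comp (toLeft s) = G.comp (toRight F G) := by
  refine FormalMor.ext_heq (fun p => p.2) fun {p q} a => HEq.trans (heq_of_eq ?_) (ident_heq _)
  rw [comp_map_eq, toLeft_map]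
  exact LinearMap.map_add_lift_sub (s.lin_lift) _ _ _

theorem blockSum_high_single {Q₁ Q₂ : GradedQuiver.{w, u, v} R} (F : FormalMor Q₁ Q₂)
    {M : Q₂.Ob → Q₂.Ob → Type*} [∀ x y, AddCommGroup (M x y)]
    (T : ∀ {x y : Q₂.Ob}, Str Q₂.Hom x y → M x y) {x y : Q₁.Ob} (f : Q₁.Hom x y) :
    F.blockSum (Str.high T) (Str.single f) = 0 := by
  rw [Str.single, FormalMor.blockSum_eq, sumCuts_cons, sumSplits_nil, sumCuts_nil]
  rfl

theorem comp_map_single {Q₁ Q₂ Q₃ : GradedQuiver.{w, u, v} R} (G : FormalMor Q₂ Q₃)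
    (F : FormalMor Q₁ Q₂) {x y : Q₁.Ob} (f : Q₁.Hom x y) :
    (G.comp F).map (Str.single f) = G.lin _ _ (F.lin _ _ f) := by
  rw [comp_map_eq]
  exact (congrArg _ (blockSum_high_single F (M := fun x y => Q₃.Hom (G.obj x) (G.obj y)) _ f)).trans
    (add_zero _)

/-- The correction term is the section applied to `G¹ a'' - F¹ a`, which vanishes on the pullback.
-/
theorem toLeft_lin {p q : (quiver F G).Ob} (f : (quiver F G).Hom p q) :
    (toLeft s).lin p q f = fst F G p q f := by
  rw [FormalMor.lin_apply, toLeft_map, comp_map_single]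
  refine Eq.trans (congrArg (fun t => fst F G p q f + s.lift _ _ t) ?_)
    ((congrArg _ (map_zero (s.lift _ _))).trans (add_zero _))
  refine (congrArg₂ (fun t t' : A'.Hom (F.obj p.1.1) (F.obj q.1.1) => t - t')
    (sub_eq_zero.2 (ident_lin_snd f)) (blockSum_high_single (toLeft s)
    (M := fun x y => A'.Hom (F.obj x) (F.obj y)) _ f)).trans (sub_zero _)

end Pullback

end AInf

/-! ### The A-infinity structure on the pullback. -/

namespace AInf

open Str GradedQuiver

variable {R : Type w} [CommRing R]

theorem GradedQuiver.insertSum_congr {Q : GradedQuiver.{w, u, v} R} {M : Q.Ob → Q.Ob → Type*}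
    [∀ x y, AddCommGroup (M x y)] {D : ∀ {x y : Q.Ob}, Str Q.Hom x y → Q.Hom x y}
    {T T' : ∀ {x y : Q.Ob}, Str Q.Hom x y → M x y}
    (h : ∀ {x y : Q.Ob} (p : Str Q.Hom x y), T p = T' p) {x y : Q.Ob} (p : Str Q.Hom x y) :
    Q.insertSum D T p = Q.insertSum D T' p :=
  congrArg (fun T : ∀ x y, Str Q.Hom x y → M x y => Q.insertSum D (fun {x y} => T x y) p)
    (funext fun _ => funext fun _ => funext fun _ => h _)

theorem GradedQuiver.insertSum_zero {Q : GradedQuiver.{w, u, v} R} {M : Q.Ob → Q.Ob → Type*}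
    [∀ x y, AddCommGroup (M x y)] {D : ∀ {x y : Q.Ob}, Str Q.Hom x y → Q.Hom x y}
    {T : ∀ {x y : Q.Ob}, Str Q.Hom x y → M x y}
    (h : ∀ {x y : Q.Ob} (p : Str Q.Hom x y), T p = 0) {x y : Q.Ob} (p : Str Q.Hom x y) :
    Q.insertSum D T p = 0 := by
  rw [insertSum_eq]
  exact sumSplits_eq_zero fun _ _ _ _ => sumSplits_eq_zero fun _ _ _ _ => h _

namespace FormalMor

variable {Q Q₁ Q₂ : GradedQuiver.{w, u, v} R}

theorem blockSum_congr (F : FormalMor Q₁ Q₂) {M : Q₂.Ob → Q₂.Ob → Type*}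
    [∀ x y, AddCommGroup (M x y)] {T T' : ∀ {x y : Q₂.Ob}, Str Q₂.Hom x y → M x y}
    (h : ∀ {x y : Q₂.Ob} (p : Str Q₂.Hom x y), T p = T' p) {x y : Q₁.Ob} (p : Str Q₁.Hom x y) :
    F.blockSum T p = F.blockSum T' p :=
  congrArg (sumCuts p) (funext fun _ => h _)

theorem blockSum_zero (F : FormalMor Q₁ Q₂) {M : Q₂.Ob → Q₂.Ob → Type*}
    [∀ x y, AddCommGroup (M x y)] {T : ∀ {x y : Q₂.Ob}, Str Q₂.Hom x y → M x y}
    (h : ∀ {x y : Q₂.Ob} (p : Str Q₂.Hom x y), T p = 0) {x y : Q₁.Ob} (p : Str Q₁.Hom x y) :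
    F.blockSum T p = 0 :=
  (congrArg (sumCuts p) (funext fun _ => h _)).trans (sumCuts_zero p)

/-- `E` is compatible with the operations `D` and `B.op` at the string `p`. -/
def Compatible {B : AInfCat.{w, u, v} R} (E : FormalMor Q B.toGradedQuiver)
    (D : ∀ {x y : Q.Ob}, Str Q.Hom x y → Q.Hom x y) {x y : Q.Ob} (p : Str Q.Hom x y) : Prop :=
  E.blockSum B.op p = Q.insertSum (M := fun x y => B.Hom (E.obj x) (E.obj y)) D E.map p

theorem Compatible.eq {B : AInfCat.{w, u, v} R} {E : FormalMor Q B.toGradedQuiver}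
    {D : ∀ {x y : Q.Ob}, Str Q.Hom x y → Q.Hom x y} {x y : Q.Ob} {p : Str Q.Hom x y}
    (h : E.Compatible D p) : E.blockSum B.op p =
      Q.insertSum (M := fun x y => B.Hom (E.obj x) (E.obj y)) D E.map p := h

/-- The defect of a composition `F · E`, where `F` is an A-infinity functor, for an operation `D`
such that `E` is compatible with `D` on shorter strings. -/
theorem comp_defect {A B : AInfCat.{w, u, v} R} (F : AInfFunctor A B)
    (E : FormalMor Q A.toGradedQuiver) {D : ∀ {x y : Q.Ob}, Str Q.Hom x y → Q.Hom x y}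
    {x y : Q.Ob} {p : Str Q.Hom x y}
    (h : ∀ {x y : Q.Ob} (q : Str Q.Hom x y), q.length < p.length → E.Compatible D q) :
    (show B.Hom (F.obj (E.obj x)) (F.obj (E.obj y)) from (F.comp E).blockSum B.op p) + F.lin _ _ (Q.insertSum
      (M := fun x y => A.Hom (E.obj x) (E.obj y)) D E.map p - E.blockSum A.op p) =
    Q.insertSum (M := fun x y => B.Hom ((F.comp E).obj x) ((F.comp E).obj y)) D
      (F.comp E).map p := by
  -- With `T = F.map`, the functor equation of `F` replaces insertions of `A.op` by `blockSum B.op`,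
  -- and associativity then gives `F.comp E`.
  have := E.insertSum_blockSum (M := fun x y => B.Hom (F.obj x) (F.obj y)) F.multilinear h
  rw [E.blockSum_congr (fun p => (F.map_op p).symm)] at this
  rw [← blockSum_blockSum F.toFormalMor E B.op_multilinear]
  exact this

/-- A formal morphism that is compatible with an operation `D` and an A-infinity structure. -/
theorem insertSum_insertSum_eq_zero {B : AInfCat.{w, u, v} R} (E : FormalMor Q B.toGradedQuiver)
    {D : ∀ {x y : Q.Ob}, Str Q.Hom x y → Q.Hom x y}
    (h : ∀ {x y : Q.Ob} (q : Str Q.Hom x y), E.Compatible D q)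
    {x y : Q.Ob} (p : Str Q.Hom x y) :
    Q.insertSum (M := fun x y => B.Hom (E.obj x) (E.obj y)) D
      (Q.insertSum (M := fun x y => B.Hom (E.obj x) (E.obj y)) D E.map) p = 0 := by
  -- The inner insertion sum is `E.blockSum B.op`. Moving the outer insertion through `E` gives
  -- `E.blockSum` of the A-infinity relation of `B`, with no defect.
  rw [← insertSum_congr (fun p => h p),
    ← E.insertSum_blockSum B.op_multilinear (p := p) fun q _ => h q, h p, sub_self,
    E.blockSum_zero fun p => B.op_op p, zero_add]
  exact (B.op_multilinear.slot nil nil).map_zero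

/-- `Str.high` removes the cut into one block, so in all other cuts the block containing `u` is a
proper part of the string. Hence `hu` is needed only for shorter strings, which permits induction on
the length. If this block is `u` alone, `hTu` applies. -/
theorem blockSum_high_append_cons (F : FormalMor Q₁ Q₂) {M : Q₂.Ob → Q₂.Ob → Type*}
    [∀ x y, AddCommGroup (M x y)] [∀ x y, Module R (M x y)]
    {T : ∀ {x y : Q₂.Ob}, Str Q₂.Hom x y → M x y} (hT : Q₂.IsMultilinear T)
    {y y' : Q₁.Ob} {u : Q₁.Hom y y'} {x z : Q₁.Ob} {p : Str Q₁.Hom y' z} {q : Str Q₁.Hom x y}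
    (hu : ∀ {x z : Q₁.Ob} (p' : Str Q₁.Hom y' z) (q' : Str Q₁.Hom x y),
      p'.length + q'.length < p.length + q.length → (p'.append (.cons u q')).length ≠ 1 →
        F.map (p'.append (.cons u q')) = 0)
    (hTu : ∀ {x z : Q₂.Ob} (p : Str Q₂.Hom (F.obj y') z) (q : Str Q₂.Hom x (F.obj y)),
      (p.append (.cons (F.map₁ u) q)).length ≠ 1 → T (p.append (.cons (F.map₁ u) q)) = 0) :
    F.blockSum (Str.high T) (p.append (.cons u q)) = 0 := by
  have hz : ∀ {s t : Q₁.Ob} (c : Str Q₁.Hom s t) {W : Str (Str Q₁.Hom) s t → M (F.obj x) (F.obj z)},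
      (∀ C, W C = 0) → sumCuts c W = 0 :=
    fun c W h => (congrArg (sumCuts c) (funext h)).trans (sumCuts_zero c)
  have key : ∀ {t t' : Q₁.Ob} (A : Str (Str Q₁.Hom) t z) (b : Str Q₁.Hom y' t)
      (b' : Str Q₁.Hom t' y) (C : Str (Str Q₁.Hom) x t'),
      (b.length + b'.length < p.length + q.length ∨ A.length = 0 ∧ C.length = 0) →
      Str.high T ((A.append (cons (b.append (cons u b')) C)).map F.obj F.map) = 0 := by
    intro t t' A b b' C h
    rw [Str.map_append, Str.map]
    unfold Str.high
    split_ifs with hlen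
    · rfl
    simp only [length_append_cons, length_map] at hlen
    by_cases hb : b.length = 0 ∧ b'.length = 0
    · obtain ⟨hb, hb'⟩ := hb
      cases b with
      | cons => simp [length] at hb
      | nil =>
        cases b' with
        | cons => simp [length] at hb'
        | nil => exact hTu _ _ (by simp only [length_append_cons, length_map]; omega)
    · rw [hu b b' (by omega) (by rw [length_append_cons]; omega)]
      exact (hT.slot _ _).map_zero
  rw [blockSum_eq, sumCuts_append_cons]
  refine sumSplits_eq_zero fun t a b hab => ?_
  cases a with
  | nil =>
    rw [sumCuts_nil]
    refine sumSplits_eq_zero fun t' b' c hbc => ?_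
    cases c with
    | nil => rw [sumCuts_nil]; exact key _ _ _ _ (Or.inr ⟨rfl, rfl⟩)
    | cons g c =>
      refine hz _ fun C => key _ _ _ _ (Or.inl ?_)
      simp only [length] at hab hbc; omega
  | cons g a =>
    refine hz _ fun A => sumSplits_eq_zero fun t' b' c hbc => hz _ fun C => key _ _ _ _ (Or.inl ?_)
    simp only [length] at hab; omega

end FormalMor

namespace Pullback

variable {A A' A'' : AInfCat.{w, u, v} R} {F : AInfFunctor A A'} {G : AInfFunctor A'' A'}
  (s : F.LinSection)

variable (G) in
/-- The recursion for the operations on the pullback. -/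
noncomputable def opStep (D : ∀ p q : (quiver F.toFormalMor G.toFormalMor).Ob,
      Str (quiver F.toFormalMor G.toFormalMor).Hom p q →
        (quiver F.toFormalMor G.toFormalMor).Hom p q)
    (p q : (quiver F.toFormalMor G.toFormalMor).Ob)
    (a : Str (quiver F.toFormalMor G.toFormalMor).Hom p q) :
    (quiver F.toFormalMor G.toFormalMor).Hom p q :=
  -- The two entries are the values forced by compatibility with the projections. `retract` places
  -- the pair in the pullback; `toLeft_op` shows that it changes nothing.
  retract s p q ((toLeft s).blockSum A.op a -
    (quiver F.toFormalMor G.toFormalMor).insertSum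
      (M := fun p q => A.Hom ((toLeft s).obj p) ((toLeft s).obj q))
      (fun {p q} => D p q) (Str.high (M := fun p q => A.Hom ((toLeft s).obj p) ((toLeft s).obj q)) (toLeft s).map) a,
    (toRight F.toFormalMor G.toFormalMor).blockSum A''.op a)

variable (G) in
theorem exists_op : ∃ D : ∀ p q : (quiver F.toFormalMor G.toFormalMor).Ob,
      Str (quiver F.toFormalMor G.toFormalMor).Hom p q →
        (quiver F.toFormalMor G.toFormalMor).Hom p q,
    IsOperation (Q := quiver F.toFormalMor G.toFormalMor)
      (quiver F.toFormalMor G.toFormalMor).deg 2 D ∧ ∀ p q a, D p q a = opStep G s D p q a := by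
  refine exists_operation _ 2 (opStep G s) ?_ (fun _ => True) trivial ?_
  · intro D D' p q a h
    unfold opStep
    rw [insertSum_high_congr fun b hb => h _ _ b hb]
  · intro D hD _
    refine ⟨⟨?_, ?_⟩, trivial⟩
    · exact IsMultilinear.comp (M := fun p q : (quiver F.toFormalMor G.toFormalMor).Ob =>
          A.Hom p.1.1 q.1.1 × A''.Hom p.1.2 q.1.2)
        (IsMultilinear.prod (IsMultilinear.sub ((toLeft s).blockSum_linear _ A.op_multilinear)
          (insertSum_multilinear hD.multilinear (toLeft s).multilinear.high))
          ((toRight F.toFormalMor G.toFormalMor).blockSum_linear _ A''.op_multilinear)) (retract s)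
    · intro p q a e ha
      refine retract_mem s (sub_mem ?_ ?_) ?_
      · exact (toLeft s).blockSum_mem (S := A.deg) A.op_mem ha
      · refine insertSum_mem (Q := quiver F.toFormalMor G.toFormalMor) (t := 1)
          (S := fun p q => A.deg ((toLeft s).obj p) ((toLeft s).obj q))
          hD.mem ?_ ha
        intro x y p e hp
        unfold Str.high
        split_ifs
        · exact zero_mem _
        · exact (toLeft s).map_mem p e hp
      · exact (toRight F.toFormalMor G.toFormalMor).blockSum_mem (S := A''.deg) A''.op_mem ha

variable (G) in
/-- The A-infinity operations on the pullback. -/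
noncomputable def op {p q : (quiver F.toFormalMor G.toFormalMor).Ob}
    (a : Str (quiver F.toFormalMor G.toFormalMor).Hom p q) :
    (quiver F.toFormalMor G.toFormalMor).Hom p q :=
  (exists_op G s).choose p q a

theorem op_isOperation : IsOperation (Q := quiver F.toFormalMor G.toFormalMor)
    (quiver F.toFormalMor G.toFormalMor).deg 2 fun _ _ => op G s :=
  (exists_op G s).choose_spec.1

theorem op_eq {p q : (quiver F.toFormalMor G.toFormalMor).Ob}
    (a : Str (quiver F.toFormalMor G.toFormalMor).Hom p q) :
    op G s a = opStep G s (fun _ _ => op G s) p q a :=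
  (exists_op G s).choose_spec.2 p q a

/-- The projection to `A''` is compatible with the operations. -/
theorem toRight_op {p q : (quiver F.toFormalMor G.toFormalMor).Ob}
    (a : Str (quiver F.toFormalMor G.toFormalMor).Hom p q) :
    (toRight F.toFormalMor G.toFormalMor).Compatible (op G s) a := by
  rw [FormalMor.Compatible, insertSum_eq_high, insertSum_zero (fun b => toRight_high b), add_zero, op_eq]
  rfl

/-- The element in question equals `ψ g`, and `φ` is injective on the image of its section `ψ`. This
is how a defect killed by `F¹` is shown to vanish. -/
theorem _root_.LinearMap.eq_zero_of_lift {V W : Type*} [AddCommGroup V] [AddCommGroup W]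
    [Module R V] [Module R W] {φ : V →ₗ[R] W} {ψ : W →ₗ[R] V} (h : ∀ g, φ (ψ g) = g)
    {a b c : V} {g : W} (hc : c = (a - b) + ψ g) (h0 : φ (c + b - a) = 0) : c + b - a = 0 := by
  have : c + b - a = ψ g := by rw [hc]; abel
  rw [this, h] at h0
  rw [this, h0, map_zero]

/-- The projection to `A` is compatible with the operations. -/
theorem toLeft_op {p q : (quiver F.toFormalMor G.toFormalMor).Ob}
    (a : Str (quiver F.toFormalMor G.toFormalMor).Hom p q) :
    (toLeft s).Compatible (op G s) a := by
  generalize hn : a.length = n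
  induction n using Nat.strong_induction_on generalizing p q with
  | _ n ih =>
    have h₁ := (toLeft s).comp_defect F (D := op G s) (p := a) fun b hb => ih _ (hn ▸ hb) b rfl
    have h₂ := (toRight F.toFormalMor G.toFormalMor).comp_defect G (D := op G s) (p := a)
      fun b _ => toRight_op s b
    rw [← (toRight_op s a).eq, sub_self, map_zero, add_zero] at h₂
    -- Compatibility passes along the equality `F · β = G · α`; comparison with `h₁` leaves `F¹` of
    -- the defect of `β` equal to zero.
    replace h₂ : (F.comp (toLeft s)).Compatible (op G s) a :=
      comp_toLeft s ▸ (show (G.comp (toRight F.toFormalMor G.toFormalMor)).Compatible _ _ from h₂)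
    replace h₁ := add_eq_left.1 (h₁.trans h₂.symm)
    refine (sub_eq_zero.1 ?_).symm
    rw [insertSum_eq_high] at h₁ ⊢
    have h₃ := (toLeft_lin s (op G s a)).trans
      ((congrArg (fst _ _ p q) (op_eq s a)).trans (fst_retract s _ _))
    exact LinearMap.eq_zero_of_lift s.lin_lift h₃ h₁

/-- If the relation holds on shorter strings, inserting twice into either projection yields its
linear component at the relation for `a`. This is zero by compatibility, and the two linear
components are jointly injective. -/
theorem op_op {p q : (quiver F.toFormalMor G.toFormalMor).Ob}
    (a : Str (quiver F.toFormalMor G.toFormalMor).Hom p q) :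
    (quiver F.toFormalMor G.toFormalMor).insertSum (op G s) (op G s) a = 0 := by
  have hsgn : ∀ {p q : (quiver F.toFormalMor G.toFormalMor).Ob}
      (a : Str (quiver F.toFormalMor G.toFormalMor).Hom p q),
      op G s (sgnStr _ a) = -sgn _ (op G s a) := by
    intro p q a
    have := map_sgnStr_of_mem (o := fun x => x) (op_isOperation s (G := G)).multilinear (t := 1)
      (fun p e hp => by
        have := (op_isOperation s (G := G)).mem p e hp
        rwa [show e + 1 + 1 - (p.length : ℤ) = e + 2 - p.length by ring]) a
    simpa using this
  generalize hn : a.length = n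
  induction n using Nat.strong_induction_on generalizing p q with
  | _ n ih =>
    have hl := insertSum_insertSum (D := op G s) (p := a) (toLeft s).multilinear hsgn
      fun b hb => ih _ (hn ▸ hb) b rfl
    have hr := insertSum_insertSum (D := op G s) (p := a)
      (toRight F.toFormalMor G.toFormalMor).multilinear hsgn
      fun b hb => ih _ (hn ▸ hb) b rfl
    rw [(toLeft s).insertSum_insertSum_eq_zero (B := A) fun b => toLeft_op s b] at hl
    rw [(toRight F.toFormalMor G.toFormalMor).insertSum_insertSum_eq_zero (B := A'')
      fun b => toRight_op s b] at hr
    refine hom_ext ?_ ?_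
    · rw [map_zero, ← toLeft_lin s]; exact hl.symm
    · rw [map_zero]; exact hr.symm

variable (G) in
/-- The pullback A-infinity category. -/
noncomputable abbrev cat : AInfCat.{w, u, v} R where
  toGradedQuiver := quiver F.toFormalMor G.toFormalMor
  op := op G s
  op_multilinear := (op_isOperation s).multilinear
  op_mem := (op_isOperation s).mem
  op_op := op_op s

end Pullback

end AInf

/-! ### Strict units. -/

namespace AInf

open Str GradedQuiver

variable {R : Type w} [CommRing R]

namespace GradedQuiver

variable {Q : GradedQuiver.{w, u, v} R} {M : Q.Ob → Q.Ob → Type*} [∀ x y, AddCommGroup (M x y)]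

/-- The value of `op (p, 1, q)` (with `T` the entry of a string) in a strictly unital category. -/
noncomputable def endSum (T : ∀ {x y : Q.Ob}, Str Q.Hom x y → M x y) {x y : Q.Ob} :
    {z : Q.Ob} → Str Q.Hom y z → Str Q.Hom x y → M x z
  | _, nil, q => -T (Q.sgnStr q)
  | _, cons f p, nil => T (cons f p)
  | _, cons _ _, cons _ _ => 0

theorem endSum_nil_right {T : ∀ {x y : Q.Ob}, Str Q.Hom x y → M x y} {x y : Q.Ob}
    (h : T (nil : Str Q.Hom x x) = 0) (p : Str Q.Hom x y) : endSum T p nil = T p := by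
  cases p with
  | nil => simp only [endSum, sgnStr_nil, h, neg_zero]
  | cons f p => rfl

theorem entry_sgnStr {x y : Q.Ob} (p : Str Q.Hom x y) :
    (Q.sgnStr p).entry = Q.sgn p.entry := by
  match p with
  | nil => exact (map_zero _).symm
  | cons _ nil => rfl
  | cons _ (cons _ _) => exact (map_zero _).symm

theorem endSum_entry_nil_right {x y : Q.Ob} (p : Str Q.Hom x y) :
    endSum (M := Q.Hom) Str.entry p nil = p.entry :=
  endSum_nil_right (M := Q.Hom) (T := Str.entry) rfl p

theorem endSum_entry_nil_single {x y : Q.Ob} (f : Q.Hom x y) :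
    endSum (M := Q.Hom) Str.entry nil (Str.single f) = -Q.sgn f := rfl

theorem endSum_entry_of_length {x y z : Q.Ob} (p : Str Q.Hom y z) (q : Str Q.Hom x y)
    (h : p.length + q.length ≠ 1) : endSum (M := Q.Hom) Str.entry p q = 0 := by
  match p, q with
  | nil, nil => exact neg_zero
  | nil, cons f nil => simp [length] at h
  | nil, cons f (cons g q) => exact neg_zero
  | cons f nil, nil => simp [length] at h
  | cons f (cons g p), nil => rfl
  | cons f p, cons g q => rfl

theorem eq_entry_add_high {T : ∀ {x y : Q.Ob}, Str Q.Hom x y → M x y} [∀ x y, Module R (M x y)]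
    (hT : Q.IsMultilinear T) {x y : Q.Ob} (h : ∀ x, T (nil : Str Q.Hom x x) = 0)
    (p : Str Q.Hom x y) : T p = T (Str.single p.entry) + Str.high T p := by
  match p with
  | nil =>
    rw [h, show Str.single (entry nil) = (nil : Str Q.Hom x x).append (cons (0 : Q.Hom x x) nil) from rfl,
      ← hT.slot_apply, map_zero, zero_add]
    rfl
  | cons _ nil => simp [Str.entry, Str.high, length, Str.single]
  | cons f (cons g p) =>
    rw [show Str.single (entry (cons f (cons g p))) = (nil : Str Q.Hom y y).append
      (cons (0 : Q.Hom x y) nil) from rfl, ← hT.slot_apply, map_zero, zero_add]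
    simp [Str.high, length]

/-- Only a piece `b` of length one contributes, namely the last entry of `p`, and putting it back
restores the string. -/
theorem sumSplits_entry {N : Type*} [AddCommGroup N] {y z x : Q.Ob} (p : Str Q.Hom y z)
    (q : Str Q.Hom x y) (T : Str Q.Hom x z → N)
    (hT : ∀ {s t} (a : Str Q.Hom t z) (b : Str Q.Hom x s), T (a.append (cons 0 b)) = 0) :
    (sumSplits p fun _ a b => T (a.append (cons b.entry q))) =
      if p.length = 0 then 0 else T (p.append q) := by
  induction p with
  | nil => rw [sumSplits_nil]; exact hT nil q
  | cons f p ih =>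
    rw [sumSplits_cons, if_neg (by simp [length])]
    rw [show (sumSplits p fun t a b => T ((cons f a).append (cons b.entry q))) = _ from
      ih (fun a => T (cons f a)) (fun a b => hT (cons f a) b)]
    cases p with
    | nil => simp only [length, if_true, add_zero]; rfl
    | cons g p =>
      rw [if_neg (by simp [length])]
      exact (congrArg (· + _) (hT nil q)).trans (zero_add _)

/-- A unit can only be absorbed by a neighbour. Absorption on the left gives `T (p, q)` with signs
on `q`, absorption on the right gives its negative. They cancel unless one side is empty, and the
surviving term is `endSum`. -/
theorem sumSplits_endSum {T : ∀ {x y : Q.Ob}, Str Q.Hom x y → M x y} [∀ x y, Module R (M x y)]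
    (hT : Q.IsMultilinear T) {x y z : Q.Ob} (h : ∀ x, T (nil : Str Q.Hom x x) = 0)
    (p : Str Q.Hom y z) (q : Str Q.Hom x y) :
    (sumSplits p fun _ a b => sumSplits q fun _ b' c =>
      T (a.append (cons (endSum (M := Q.Hom) Str.entry b b') (Q.sgnStr c)))) = endSum T p q := by
  have h0 : ∀ {x z s t : Q.Ob} (a : Str Q.Hom t z) (b : Str Q.Hom x s),
    T (a.append (cons 0 b)) = 0 := fun a b => (hT.slot a b).map_zero
  have hn : ∀ {x z s t : Q.Ob} (a : Str Q.Hom t z) (f : Q.Hom s t) (b : Str Q.Hom x s),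
    T (a.append (cons (-f) b)) = -T (a.append (cons f b)) := fun a f b => (hT.slot a b).map_neg f
  cases q with
  | nil =>
    simp only [sumSplits_nil, endSum_entry_nil_right, sgnStr_nil]
    rw [sumSplits_entry p nil (fun a => T a) h0, endSum_nil_right (h _), append_nil]
    cases p with
    | nil => simp [length, h]
    | cons => simp [length]
  | cons g q =>
    simp only [sumSplits_cons, sumSplits_add, endSum_entry_nil_right]
    rw [sumSplits_entry p (Q.sgnStr (cons g q)) (fun a => T a) h0, sumSplits_of_left]
    · simp only [endSum, hn]
      rw [← sumSplits_neg, sumSplits_of_right]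
      · cases p with
        | nil => simp [length, Str.append, sgnStr_cons, Str.entry, sgnStr_nil]
        | cons => simp [length, sgnStr_cons, Str.entry, sgnStr_nil]
      · intro t a b _ ha
        rw [entry_sgnStr]
        cases a with
        | nil => simp [length] at ha
        | cons => rw [show Str.entry (cons g (cons _ _)) = 0 from rfl, map_zero, h0]
    · intro t a b _ hb
      refine sumSplits_eq_zero fun s c d _ => ?_
      cases b with
      | nil => simp [length] at hb
      | cons => exact h0 _ _

end GradedQuiver

/-- A term survives only if one side has no blocks and the other is a single block, which is then
the whole string. -/
theorem FormalMor.sumCuts_endSum {Q₁ Q₂ : GradedQuiver.{w, u, v} R} (E : FormalMor Q₁ Q₂)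
    {x y z : Q₁.Ob} (p : Str Q₁.Hom y z) (q : Str Q₁.Hom x y) :
    (sumCuts p fun A => sumCuts q fun C => endSum (M := Q₂.Hom) Str.entry (A.map E.obj E.map)
      (C.map E.obj E.map)) =
      endSum (M := fun x y => Q₂.Hom (E.obj x) (E.obj y)) E.map p q := by
  have key : ∀ {y z : Q₁.Ob} (p : Str Q₁.Hom y z),
      (sumCuts p fun A => (A.map E.obj E.map).entry) = E.map p := by
    intro y z p
    by_cases hp : p.length = 0
    · cases p with
      | nil => rw [sumCuts_nil, E.map_nil]; rfl
      | cons => simp [length] at hp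
    · rw [sumCuts_of_length hp]
      · rfl
      · intro B hB
        match B with
        | nil => rfl
        | cons _ nil => simp [length] at hB
        | cons _ (cons _ _) => rfl
  cases p with
  | nil =>
    simp only [sumCuts_nil, Str.map, endSum, entry_sgnStr]
    rw [E.map_sgnStr, ← key q]
    exact (map_sumCuts (-Q₂.sgn) q _).symm
  | cons f p =>
    cases q with
    | nil =>
      simp only [sumCuts_nil, Str.map, endSum_entry_nil_right, key]
      rfl
    | cons g q =>
      simp only [sumCuts_cons, Str.map, endSum]
      exact sumSplits_eq_zero fun t a b _ => Eq.trans (congrArg (sumCuts b) (funext fun A =>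
        sumSplits_eq_zero fun _ _ c _ => sumCuts_zero c)) (sumCuts_zero b)

namespace SUCat

/-- All unit laws in one formula without homogeneity: the left law extends by linearity, as
`(-1)^(deg f) f` is `-sgn f`. -/
theorem op_one_eq (A : SUCat.{w, u, v} R) {x y z : A.Ob} (p : Str A.Hom y z) (q : Str A.Hom x y) :
    A.op (p.append (cons (A.one y) q)) = endSum (M := A.Hom) Str.entry p q := by
  have hl : ∀ {x y : A.Ob} (f : A.Hom x y),
      A.op (cons (A.one y) (Str.single f)) = -A.sgn f := by
    intro x y f
    refine LinearMap.congr_fun (f := A.op_multilinear.slot (Str.single (A.one y)) nil)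
      (g := -A.toGradedQuiver.sgn) (linearMap_ext fun d f hf => ?_) f
    refine (A.op_one_left d f hf).trans ?_
    rw [LinearMap.neg_apply, A.sgn_of_mem hf, Int.negOnePow_sub, Int.negOnePow_one]
    simp
  by_cases h : p.length + q.length = 1
  · match p, q with
    | nil, cons f nil => exact hl f
    | cons f nil, nil => exact A.op_one_right f
    | nil, nil => simp [length] at h
    | nil, cons f (cons g q) => simp only [length] at h; omega
    | cons f (cons g p), nil => simp only [length] at h; omega
    | cons f p, cons g q => simp only [length] at h; omega
  · rw [endSum_entry_of_length p q h, A.op_one p q (by rw [length_append_cons]; omega)]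

/-- That the unit is homogeneous of degree zero is not among the axioms. The sign follows by
evaluating `op (1, 1)` with both the left and the right unit law. -/
theorem sgn_one (A : SUCat.{w, u, v} R) (x : A.Ob) : A.sgn (A.one x) = -A.one x := by
  have h := (A.op_one_eq nil (Str.single (A.one x))).symm.trans (A.op_one_right (A.one x))
  exact neg_eq_iff_eq_neg.1 h

theorem castHom_one (A : SUCat.{w, u, v} R) {x y : A.Ob} (h : x = y) :
    A.castHom h h (A.one x) = A.one y := by
  subst h
  rfl

end SUCat

namespace FormalMor

variable {Q : GradedQuiver.{w, u, v} R} {B : SUCat.{w, u, v} R}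

theorem lin_sgn {Q' : GradedQuiver.{w, u, v} R} (E : FormalMor Q Q') {x y : Q.Ob} (f : Q.Hom x y) :
    E.lin x y (Q.sgn f) = Q'.sgn (E.lin x y f) :=
  E.map_sgnStr (Str.single f)

/-- If `E` is compatible with `D` and with units `u ↦ 1`, and `D` has the expected values at
strings with entry `u` shorter than `(p, u, q)`, then so does the image of `D (p, u, q)`. -/
theorem lin_op_unit (E : FormalMor Q B.toGradedQuiver)
    {D : ∀ {x y : Q.Ob}, Str Q.Hom x y → Q.Hom x y} (hD : ∀ {x y : Q.Ob} (p : Str Q.Hom x y),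
      E.Compatible (B := B.toAInfCat) D p) {y : Q.Ob} {u : Q.Hom y y} (hu : E.map₁ u = B.one (E.obj y))
    (hsgn : Q.sgn u = -u)
    (hE : ∀ {x z : Q.Ob} (p : Str Q.Hom y z) (q : Str Q.Hom x y),
      (p.append (.cons u q)).length ≠ 1 → E.map (p.append (.cons u q)) = 0)
    {x z : Q.Ob} (p : Str Q.Hom y z) (q : Str Q.Hom x y)
    (ih : ∀ {x z : Q.Ob} (p' : Str Q.Hom y z) (q' : Str Q.Hom x y),
      p'.length + q'.length < p.length + q.length →
        D (p'.append (cons u q')) = endSum (M := Q.Hom) Str.entry p' q') :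
    E.lin _ _ (D (p.append (cons u q))) =
      E.lin _ _ (endSum (M := Q.Hom) Str.entry p q) := by
  have hh : ∀ {x z : Q.Ob} (p : Str Q.Hom y z) (q : Str Q.Hom x y),
      Str.high (M := fun x y => B.Hom (E.obj x) (E.obj y)) E.map (p.append (.cons u q)) = 0 := by
    intro x z p q
    unfold Str.high
    split_ifs with h
    · rfl
    · exact hE p q (by omega)
  have hml := E.multilinear.high (M := fun x y => B.Hom (E.obj x) (E.obj y))
  have hhn : ∀ {x z : Q.Ob} (p : Str Q.Hom y z) (q : Str Q.Hom x y),
      Str.high (M := fun x y => B.Hom (E.obj x) (E.obj y)) E.map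
        (p.append (.cons (Q.sgn u) q)) = 0 := by
    intro x z p q
    rw [hsgn, ← hml.slot_apply, map_neg, hml.slot_apply, hh, neg_zero]
  have h₁ : Q.insertSum (M := fun x y => B.Hom (E.obj x) (E.obj y)) D
      (Str.high (M := fun x y => B.Hom (E.obj x) (E.obj y)) E.map) (p.append (cons u q)) =
      endSum (M := fun x y => B.Hom (E.obj x) (E.obj y))
        (Str.high (M := fun x y => B.Hom (E.obj x) (E.obj y)) E.map) p q := by
    rw [insertSum_append_cons, ← sumSplits_endSum hml (fun x => rfl)]
    rw [sumSplits_eq_zero (p := p), zero_add, sumSplits_eq_zero (p := q), add_zero]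
    · refine sumSplits_congr fun t a b hab => sumSplits_congr fun t' b' c hbc => ?_
      -- When the window is the whole string, the result has length one and `Str.high` kills both
      -- sides, so the induction hypothesis is not needed there.
      by_cases h : b.length + b'.length < p.length + q.length
      · rw [ih b b' h]
      · unfold Str.high
        rw [if_pos, if_pos] <;> simp only [length_append_cons, length_sgnStr] <;> omega
    · intro s r c _
      refine sumSplits_eq_zero fun t a b _ => ?_
      exact hh p _
    · intro s r c _
      refine sumSplits_eq_zero fun t a b _ => ?_
      have := hhn (a.append (cons (D b) (Q.sgnStr c))) (Q.sgnStr q)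
      rwa [append_assoc] at this
  -- In the compatibility equation one side is `endSum` of `E.map` and the higher insertions are
  -- `endSum` of its higher part; their difference is the linear part of `E` at `endSum` of the
  -- entry.
  have h₂ := (hD (p.append (cons u q))).eq
  rw [insertSum_eq_high, h₁, E.blockSum_append_cons hE B.op_multilinear, hu] at h₂
  simp only [B.op_one_eq] at h₂
  rw [E.sumCuts_endSum] at h₂
  rw [lin_apply, ← sub_eq_iff_eq_add.2 h₂]
  have h₃ : ∀ {x y : Q.Ob} (p : Str Q.Hom x y), E.map p - Str.high
      (M := fun x y => B.Hom (E.obj x) (E.obj y)) E.map p = E.lin _ _ p.entry := fun p =>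
    sub_eq_iff_eq_add.2 (eq_entry_add_high E.multilinear
      (M := fun x y => B.Hom (E.obj x) (E.obj y)) E.map_nil p)
  match p, q with
  | nil, q =>
    simp only [endSum]
    rw [map_neg, ← h₃]; abel
  | cons f p, nil => exact h₃ _
  | cons f p, cons g q => simp only [endSum, map_zero, sub_zero]

end FormalMor

namespace Pullback

variable {A A' A'' : SUCat.{w, u, v} R} {F : SUFunctor A A'} {G : SUFunctor A'' A'}
  (s : F.LinSection)

variable (F G) in
/-- The units of the pullback. -/
def one (p : (quiver F.toFormalMor G.toFormalMor).Ob) :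
    (quiver F.toFormalMor G.toFormalMor).Hom p p :=
  ⟨(A.one p.1.1, A''.one p.1.2), by
    rw [LinearMap.mem_ker, diff_apply, FormalMor.lin_apply, FormalMor.lin_apply, F.map_one,
      G.map_one, ident, A'.castHom_one, sub_self]⟩

theorem toRight_one (p : (quiver F.toFormalMor G.toFormalMor).Ob) :
    (toRight F.toFormalMor G.toFormalMor).map₁ (one F G p) = A''.one p.1.2 := rfl

theorem toLeft_one (p : (quiver F.toFormalMor G.toFormalMor).Ob) :
    (toLeft s).map₁ (one F G p) = A.one p.1.1 :=
  toLeft_lin s (one F G p)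

theorem sgn_one (s : F.LinSection) (p : (quiver F.toFormalMor G.toFormalMor).Ob) :
    sgn _ (one F G p) = -one F G p := by
  refine hom_ext ?_ ?_
  · rw [map_neg, ← toLeft_lin s, ← toLeft_lin s, FormalMor.lin_sgn,
      show (toLeft s).lin p p (one F G p) = _ from toLeft_one s p]
    exact A.sgn_one p.1.1
  · rw [map_neg]
    exact ((toRight F.toFormalMor G.toFormalMor).lin_sgn (one F G p)).trans (A''.sgn_one p.1.2)

theorem toRight_cons_one {p q r : (quiver F.toFormalMor G.toFormalMor).Ob}
    (a : Str (quiver F.toFormalMor G.toFormalMor).Hom q r)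
    (b : Str (quiver F.toFormalMor G.toFormalMor).Hom p q)
    (h : (a.append (cons (one F G q) b)).length ≠ 1) :
    (toRight F.toFormalMor G.toFormalMor).map (a.append (cons (one F G q) b)) = 0 := by
  have h' := toRight_high (a.append (cons (one F G q) b))
  unfold Str.high at h'
  rwa [if_neg] at h'
  rw [length_append_cons] at h ⊢; omega

theorem entry_append_cons {Q : GradedQuiver.{w, u, v} R} {x y y' z : Q.Ob} (p : Str Q.Hom y' z)
    (f : Q.Hom y y') (q : Str Q.Hom x y) (h : (p.append (cons f q)).length ≠ 1) :
    (p.append (cons f q)).entry = 0 := by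
  cases p with
  | nil =>
    cases q with
    | nil => simp [length, Str.append] at h
    | cons => rfl
  | cons g p => cases p <;> rfl

/-- In the recursion for `β`, the term from `G · α` vanishes since `α` and `G` are strictly unital;
the higher terms of `F` vanish since `F` is strictly unital and `β` kills units in shorter strings.
-/
theorem toLeft_cons_one {p q r : (quiver F.toFormalMor G.toFormalMor).Ob}
    (a : Str (quiver F.toFormalMor G.toFormalMor).Hom q r)
    (b : Str (quiver F.toFormalMor G.toFormalMor).Hom p q)
    (h : (a.append (cons (one F G q) b)).length ≠ 1) :
    (toLeft s).map (a.append (cons (one F G q) b)) = 0 := by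
  generalize hn : a.length + b.length = n
  induction n using Nat.strong_induction_on generalizing p r with
  | _ n ih =>
    have h₁ : (G.comp (toRight F.toFormalMor G.toFormalMor)).map
        (a.append (cons (one F G q) b)) = 0 := by
      rw [comp_map_eq, toRight_cons_one a b h, map_zero, zero_add]
      exact (toRight F.toFormalMor G.toFormalMor).blockSum_high_append_cons G.multilinear
        (fun a b _ h => toRight_cons_one a b h) fun a b h => G.map_cons_one a b h
    have h₂ : (toLeft s).blockSum (Str.high (M := fun x y => A'.Hom (F.obj x) (F.obj y)) F.map)
        (a.append (cons (one F G q) b)) = 0 := by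
      refine (toLeft s).blockSum_high_append_cons F.multilinear
        (fun a b hab h => ih _ (hn ▸ hab) a b h rfl) fun a b h => ?_
      rw [toLeft_one] at h ⊢
      exact F.map_cons_one a b h
    rw [toLeft_map, entry_append_cons a _ b h, map_zero, zero_add]
    have h₃ : ∀ t t' : A'.Hom (F.obj p.1.1) (F.obj r.1.1), t = 0 → t' = 0 →
        s.lift p.1.1 r.1.1 ((t - F.lin _ _ 0) - t') = 0 := by
      rintro _ _ rfl rfl
      simp
    exact h₃ _ _ ((congrArg (ident _ _ p r) h₁).trans (map_zero _)) h₂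

/-- Both projections are compatible with the operations and send units to units, so `lin_op_unit`
computes each entry. -/
theorem op_one {p q r : (quiver F.toFormalMor G.toFormalMor).Ob}
    (a : Str (quiver F.toFormalMor G.toFormalMor).Hom q r)
    (b : Str (quiver F.toFormalMor G.toFormalMor).Hom p q) :
    op G.toAInfFunctor s (a.append (cons (one F G q) b)) =
      endSum (M := (quiver F.toFormalMor G.toFormalMor).Hom) Str.entry a b := by
  generalize hn : a.length + b.length = n
  induction n using Nat.strong_induction_on generalizing p r with
  | _ n ih =>
    refine hom_ext ?_ ?_
    · rw [← toLeft_lin s, ← toLeft_lin s]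
      exact (toLeft s).lin_op_unit (toLeft_op s) (toLeft_one s q) (sgn_one s q) (toLeft_cons_one s) a b
        fun a' b' h => ih _ (hn ▸ h) a' b' rfl
    · exact (toRight F.toFormalMor G.toFormalMor).lin_op_unit (toRight_op s) (toRight_one q)
        (sgn_one s q) toRight_cons_one a b fun a' b' h => ih _ (hn ▸ h) a' b' rfl

variable (G) in
/-- The pullback as a strictly unital A-infinity category. -/
noncomputable abbrev suCat : SUCat.{w, u, v} R where
  toAInfCat := cat G.toAInfFunctor s
  one := one F G
  op_one a b h := by
    rw [length_append_cons] at h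
    exact (op_one s a b).trans (endSum_entry_of_length a b (by omega))
  op_one_left d f hf := by
    refine (op_one s nil (Str.single f)).trans ((endSum_entry_nil_single f).trans ?_)
    rw [sgn_of_mem _ hf, Int.negOnePow_sub, Int.negOnePow_one]
    simp
  op_one_right f := op_one s (Str.single f) nil

variable (G) in
/-- The projection to `A''` as a strictly unital A-infinity functor. -/
noncomputable abbrev right : SUFunctor (suCat G s) A'' where
  toFormalMor := toRight F.toFormalMor G.toFormalMor
  map_op := toRight_op s
  map_one := toRight_one
  map_cons_one := toRight_cons_one

variable (G) in
/-- The projection to `A` as a strictly unital A-infinity functor. -/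
noncomputable abbrev left : SUFunctor (suCat G s) A where
  toFormalMor := toLeft s
  map_op := toLeft_op s
  map_one := toLeft_one s
  map_cons_one := toLeft_cons_one s

end Pullback

end AInf

/-! ### The universal property and the conclusion. -/

namespace AInf

open Str GradedQuiver

variable {R : Type w} [CommRing R]

theorem FormalMor.map_heq {Q₁ Q₂ : GradedQuiver.{w, u, v} R} {F G : FormalMor Q₁ Q₂} (h : F = G)
    {x y : Q₁.Ob} (p : Str Q₁.Hom x y) : F.map p ≍ G.map p := by
  subst h
  rfl

theorem SUFunctor.ext_formalMor {A B : SUCat.{w, u, v} R} {F G : SUFunctor A B}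
    (h : F.toFormalMor = G.toFormalMor) : F = G := by
  obtain ⟨⟨f, _⟩, _, _⟩ := F
  obtain ⟨⟨g, _⟩, _, _⟩ := G
  obtain rfl : f = g := h
  rfl

theorem SUFunctor.compatible {A B : SUCat.{w, u, v} R} (F : SUFunctor A B) {x y : A.Ob}
    (p : Str A.Hom x y) : F.Compatible (B := B.toAInfCat) A.op p :=
  F.map_op p

namespace Pullback

section

variable {A A' A'' Q : GradedQuiver.{w, u, v} R} {F : FormalMor A A'} {G : FormalMor A'' A'}
  (s : F.LinSection)

theorem comp_toRight_map (N : FormalMor Q (quiver F G)) {x y : Q.Ob} (p : Str Q.Hom x y) :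
    ((toRight F G).comp N).map p = snd F G _ _ (N.map p) := by
  rw [comp_map_eq, N.blockSum_zero fun q => toRight_high q, add_zero]
  rfl

theorem comp_toLeft_map (N : FormalMor Q (quiver F G)) {x y : Q.Ob} (p : Str Q.Hom x y) :
    ((toLeft s).comp N).map p = fst F G _ _ (N.map p) +
      (show A.Hom (N.obj x).1.1 (N.obj y).1.1 from N.blockSum (Str.high
        (M := fun x y => A.Hom ((toLeft s).obj x) ((toLeft s).obj y)) (toLeft s).map) p) := by
  rw [comp_map_eq, toLeft_lin]
  rfl

/-- A formal morphism to the pullback is determined by its compositions with the projections. -/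
theorem formalMor_ext {N N' : FormalMor Q (quiver F G)}
    (hr : (toRight F G).comp N = (toRight F G).comp N')
    (hl : (toLeft s).comp N = (toLeft s).comp N') : N = N' := by
  have ho : ∀ x, N.obj x = N'.obj x := fun x => Subtype.ext
    (Prod.ext (congrFun (congrArg FormalMor.obj hl) x) (congrFun (congrArg FormalMor.obj hr) x))
  obtain ⟨o, φ, h₁, h₂, h₃⟩ := N
  obtain ⟨o', φ', h₁', h₂', h₃'⟩ := N'
  obtain rfl : o = o' := funext ho
  refine FormalMor.ext_heq (fun _ => rfl) fun {x y} p => heq_of_eq ?_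
  change φ p = φ' p
  generalize hn : p.length = n
  induction n using Nat.strong_induction_on generalizing x y with
  | _ n ih =>
    have el := eq_of_heq (FormalMor.map_heq hl p)
    have er := eq_of_heq (FormalMor.map_heq hr p)
    rw [comp_toRight_map] at er
    replace er := er.trans (comp_toRight_map _ p)
    replace el := (comp_toLeft_map s _ p).symm.trans (el.trans (comp_toLeft_map s _ p))
    refine hom_ext ?_ er
    -- The higher terms of `β · N` involve `N` only on shorter strings, so they agree by induction
    -- and the first entries of `N` and `N'` can be compared.
    refine add_right_cancel (el.trans (congrArg _ ?_))
    exact (sumCuts_map_congr_of_lt (fun q hq => ih _ (hn ▸ hq) q rfl)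
      (W := Str.high (M := fun x y => A.Hom ((toLeft s).obj x) ((toLeft s).obj y)) (toLeft s).map)
      fun q hq => if_pos hq).symm

variable {L : FormalMor Q A''} {I : FormalMor Q A} (h : F.comp I = G.comp L)

/-- The map of objects induced by a commutative square. -/
def inducedOb (x : Q.Ob) : (quiver F G).Ob :=
  ⟨(I.obj x, L.obj x), congrFun (congrArg FormalMor.obj h) x⟩

/-- The recursion for the formal morphism induced by a commutative square. -/
noncomputable def inducedStep
    (φ : ∀ x y : Q.Ob, Str Q.Hom x y → (quiver F G).Hom (inducedOb h x) (inducedOb h y))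
    (x y : Q.Ob) (p : Str Q.Hom x y) : (quiver F G).Hom (inducedOb h x) (inducedOb h y) :=
  -- The first entry is the solution of `β · N = I` for the top component of `N`; whether the pair
  -- already lies in the pullback is left open here, so it is retracted.
  retract s (inducedOb h x) (inducedOb h y) (I.map p - sumCuts (M := A.Hom (I.obj x) (I.obj y)) p fun B =>
    Str.high (M := fun x y => A.Hom ((toLeft s).obj x) ((toLeft s).obj y)) (toLeft s).map
      (B.map (inducedOb h) fun {x y} => φ x y), L.map p)

theorem inducedStep_nil
    (φ : ∀ x y : Q.Ob, Str Q.Hom x y → (quiver F G).Hom (inducedOb h x) (inducedOb h y)) (x : Q.Ob) :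
    inducedStep s h φ x x nil = 0 := by
  unfold inducedStep
  rw [I.map_nil, L.map_nil]
  refine Eq.trans (congrArg (fun t => retract s (inducedOb h x) (inducedOb h x) (0 - t, 0))
    ((sumCuts_nil _).trans rfl : _ = (0 : A.Hom (I.obj x) (I.obj x)))) ?_
  exact (congrArg (fun t => retract s (inducedOb h x) (inducedOb h x) (t, 0))
    (sub_zero (0 : A.Hom (I.obj x) (I.obj x)))).trans (map_zero _)

theorem exists_induced :
    ∃ φ : ∀ x y : Q.Ob, Str Q.Hom x y → (quiver F G).Hom (inducedOb h x) (inducedOb h y),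
      IsOperation (M := fun x y => (quiver F G).Hom (inducedOb h x) (inducedOb h y))
        (fun x y => (quiver F G).deg (inducedOb h x) (inducedOb h y)) 1 φ ∧
      ∀ x y p, φ x y p = inducedStep s h φ x y p := by
  refine exists_operation (M := fun x y => (quiver F G).Hom (inducedOb h x) (inducedOb h y))
    _ 1 (inducedStep s h) ?_ (fun φ => ∀ x, φ x x nil = 0) (fun _ => rfl) ?_
  · intro φ φ' x y p hp
    exact congrArg (fun t : A.Hom (I.obj x) (I.obj y) =>
      retract s (inducedOb h x) (inducedOb h y) (I.map p - t, L.map p))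
      (sumCuts_map_congr_of_lt (fun q hq => hp _ _ q hq)
        (W := Str.high (M := fun x y => A.Hom ((toLeft s).obj x) ((toLeft s).obj y)) (toLeft s).map)
        fun q hq => if_pos hq)
  · intro φ hφ h0
    let N : FormalMor Q (quiver F G) := ⟨inducedOb h, fun {x y} => φ x y, h0, hφ.multilinear,
      fun p e hp => hφ.mem p e hp⟩
    have hml := (toLeft (G := G) s).multilinear.high
      (M := fun x y => A.Hom ((toLeft (G := G) s).obj x) ((toLeft (G := G) s).obj y))
    refine ⟨⟨?_, ?_⟩, inducedStep_nil s h φ⟩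
    · exact IsMultilinear.comp
        (M := fun x y => A.Hom (I.obj x) (I.obj y) × A''.Hom (L.obj x) (L.obj y))
        (IsMultilinear.prod (IsMultilinear.sub I.multilinear (N.blockSum_linear _ hml))
          L.multilinear) fun x y => retract s (inducedOb h x) (inducedOb h y)
    · intro x y p e hp
      refine retract_mem s (sub_mem (I.map_mem p e hp) ?_) (L.map_mem p e hp)
      refine N.blockSum_mem (M := fun x y => A.Hom ((toLeft s).obj x) ((toLeft s).obj y))
        (S := fun x y => A.deg ((toLeft s).obj x) ((toLeft s).obj y)) ?_ hp
      intro x y p e hp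
      unfold Str.high
      split_ifs
      · exact zero_mem _
      · exact (toLeft s).map_mem p e hp

/-- The formal morphism to the pullback induced by a commutative square. -/
noncomputable def induced : FormalMor Q (quiver F G) where
  obj := inducedOb h
  map {x y} := (exists_induced s h).choose x y
  map_nil x := by rw [(exists_induced s h).choose_spec.2, inducedStep_nil]
  multilinear := (exists_induced s h).choose_spec.1.multilinear
  map_mem p e hp := (exists_induced s h).choose_spec.1.mem p e hp

theorem induced_map {x y : Q.Ob} (p : Str Q.Hom x y) :
    (induced s h).map p = inducedStep s h (fun _ _ => (induced s h).map) x y p :=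
  (exists_induced s h).choose_spec.2 x y p

theorem toRight_comp_induced : (toRight F G).comp (induced s h) = L :=
  FormalMor.ext_heq (fun _ => rfl) fun p => heq_of_eq
    ((comp_toRight_map _ p).trans (congrArg (snd F G _ _) (induced_map s h p)))

/-- After composition with `F` the equation holds, since `F · β · N = G · α · N = G · L = F · I`. By
induction the higher terms of `F` agree, so `F¹` kills the difference of the two sides; the
difference lies in the image of `s` and is therefore zero. -/
theorem toLeft_comp_induced : (toLeft s).comp (induced s h) = I := by
  have hc : F.comp ((toLeft s).comp (induced s h)) = F.comp I := by
    rw [← FormalMor.comp_assoc, comp_toLeft, FormalMor.comp_assoc, toRight_comp_induced, h]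
  refine FormalMor.ext_heq (fun _ => rfl) fun {x y} p => heq_of_eq ?_
  generalize hn : p.length = n
  induction n using Nat.strong_induction_on generalizing x y with
  | _ n ih =>
    have e := eq_of_heq (FormalMor.map_heq hc p)
    replace e := (comp_map_eq _ _ p).symm.trans (e.trans (comp_map_eq _ _ p))
    have e' : ((toLeft s).comp (induced s h)).blockSum
        (Str.high (M := fun x y => A'.Hom (F.obj x) (F.obj y)) F.map) p =
        I.blockSum (Str.high (M := fun x y => A'.Hom (F.obj x) (F.obj y)) F.map) p :=
      sumCuts_map_congr_of_lt (fun q hq => ih _ (hn ▸ hq) q rfl)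
        (W := Str.high (M := fun x y => A'.Hom (F.obj x) (F.obj y)) F.map)
        fun q hq => if_pos hq
    replace e := add_right_cancel (G := A'.Hom (F.obj (I.obj x)) (F.obj (I.obj y)))
      (e.trans (congrArg _ e'.symm))
    have hp := comp_toLeft_map s (induced s h) p
    have h₁ := (congrArg (fst F G _ _) (induced_map s h p)).trans (fst_retract s _ _)
    refine (sub_eq_zero (G := A.Hom (I.obj x) (I.obj y))).1
      ((congrArg (fun t : A.Hom (I.obj x) (I.obj y) => t - I.map p) hp).trans ?_)
    refine LinearMap.eq_zero_of_lift s.lin_lift h₁ ?_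
    exact (map_sub _ _ _).trans (sub_eq_zero.2 ((congrArg _ hp.symm).trans e))

end

section

variable {A A' A'' C : SUCat.{w, u, v} R} {F : SUFunctor A A'} {G : SUFunctor A'' A'}
  (s : F.LinSection) {L : SUFunctor C A''} {I : SUFunctor C A}
  (h : F.toFormalMor.comp I.toFormalMor = G.toFormalMor.comp L.toFormalMor)

/-- The compositions of `N` with both projections are A-infinity functors, so by `comp_defect` both
linear projections kill the first defect of `N`. -/
theorem induced_op {x y : C.Ob} (p : Str C.Hom x y) :
    (induced s h).Compatible (B := cat G.toAInfFunctor s) C.op p := by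
  generalize hn : p.length = n
  induction n using Nat.strong_induction_on generalizing x y with
  | _ n ih =>
    have hl := FormalMor.comp_defect (left G s).toAInfFunctor (induced s h) (D := C.op) (p := p)
      fun q hq => ih _ (hn ▸ hq) q rfl
    have hr := FormalMor.comp_defect (right G s).toAInfFunctor (induced s h) (D := C.op) (p := p)
      fun q hq => ih _ (hn ▸ hq) q rfl
    have hl' : ((toLeft s).comp (induced s h)).Compatible (B := A.toAInfCat) C.op p :=
      (toLeft_comp_induced s h).symm ▸ I.compatible p
    have hr' : ((toRight F.toFormalMor G.toFormalMor).comp (induced s h)).Compatible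
        (B := A''.toAInfCat) C.op p :=
      (toRight_comp_induced s h).symm ▸ L.compatible p
    replace hl := add_eq_left.1 (hl.trans hl'.eq.symm)
    replace hr := add_eq_left.1 (hr.trans hr'.eq.symm)
    refine (sub_eq_zero.1 (hom_ext ?_ ?_)).symm
    · exact ((toLeft_lin s _).symm.trans hl).trans (map_zero _).symm
    · exact hr.trans (map_zero _).symm

theorem induced_one (x : C.Ob) :
    (induced s h).map (Str.single (C.one x)) = one F G (inducedOb h x) := by
  refine hom_ext ?_ ?_
  · have e := eq_of_heq (FormalMor.map_heq (toLeft_comp_induced s h) (Str.single (C.one x)))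
    rw [comp_map_single, toLeft_lin] at e
    exact e.trans (I.map_one x)
  · have e := eq_of_heq (FormalMor.map_heq (toRight_comp_induced s h) (Str.single (C.one x)))
    rw [comp_toRight_map] at e
    exact e.trans (L.map_one x)

/-- The second entry is a value of `L`. The first is a value of `I` minus higher terms of `β · N`,
which vanish by strict unitality of `β` and induction. -/
theorem induced_cons_one {x y z : C.Ob} (p : Str C.Hom y z) (q : Str C.Hom x y)
    (hpq : (p.append (cons (C.one y) q)).length ≠ 1) :
    (induced s h).map (p.append (cons (C.one y) q)) = 0 := by
  generalize hn : p.length + q.length = n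
  induction n using Nat.strong_induction_on generalizing x z with
  | _ n ih =>
    refine hom_ext ?_ ?_
    · have e := eq_of_heq (FormalMor.map_heq (toLeft_comp_induced s h)
        (p.append (cons (C.one y) q)))
      have h₀ : (induced s h).blockSum (Str.high (M := fun x y => A.Hom ((toLeft s).obj x)
          ((toLeft s).obj y)) (toLeft s).map) (p.append (cons (C.one y) q)) = 0 := by
        refine (induced s h).blockSum_high_append_cons (toLeft s).multilinear
          (fun a b hab hl => ih _ (hn ▸ hab) a b hl rfl) fun a b hl => ?_
        have h₁ : (induced s h).map₁ (C.one y) = one F G (inducedOb h y) := induced_one s h y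
        rw [h₁] at hl ⊢
        exact toLeft_cons_one s a b hl
      replace e := (comp_toLeft_map s _ _).symm.trans (e.trans (I.map_cons_one p q hpq))
      exact ((add_zero _).symm.trans ((congrArg _ h₀.symm).trans e)).trans (map_zero _).symm
    · have e := eq_of_heq (FormalMor.map_heq (toRight_comp_induced s h)
        (p.append (cons (C.one y) q)))
      rw [comp_toRight_map] at e
      exact (e.trans (L.map_cons_one p q hpq)).trans (map_zero _).symm

/-- The strictly unital A-infinity functor to the pullback induced by a commutative square. -/
noncomputable def inducedFunctor : SUFunctor C (suCat G s) where
  toFormalMor := induced s h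
  map_op := induced_op s h
  map_one := induced_one s h
  map_cons_one := induced_cons_one s h

theorem isPullback : IsPullback (right G s) (left G s) F G where
  comm := comp_toLeft s
  existsUnique C L I h := by
    refine ⟨inducedFunctor s h, ⟨toRight_comp_induced s h, toLeft_comp_induced s h⟩, ?_⟩
    rintro N ⟨hr, hl⟩
    exact SUFunctor.ext_formalMor (formalMor_ext s (hr.trans (toRight_comp_induced s h).symm)
      (hl.trans (toLeft_comp_induced s h).symm))

end

end Pullback

/-- A section of `F¹` by graded linear maps, for a functor that satisfies (F1). -/
noncomputable def SUFunctor.F1.linSection {A B : SUCat.{w, u, v} R} {F : SUFunctor A B}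
    (hF : F.F1) : F.LinSection where
  lift x y := (hF x y).choose
  lift_mem hg := (hF _ _).choose_spec.1 _ _ hg
  lin_lift g := (hF _ _).choose_spec.2 g

end AInf

open AInf AInf.Pullback in
theorem mainTheorem4 {R : Type w} [CommRing R] (A A' A'' : AInf.SUCat.{w, u, v} R)
    (F : AInf.SUFunctor A A') (hF : F.F1) (G : AInf.SUFunctor A'' A') :
    ∃ (P : AInf.SUCat.{w, u, v} R) (α : AInf.SUFunctor P A'') (β : AInf.SUFunctor P A),
      AInf.IsPullback α β F G ∧
      -- objects of `P` are the pairs `(x, y)` with `F x = G y`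
      (∀ (x : A.Ob) (y : A''.Ob), F.obj x = G.obj y → ∃! p : P.Ob, β.obj p = x ∧ α.obj p = y) ∧
      -- morphisms of `P` are the pairs `(a, a'')` with `F¹ a = G¹ a''`
      (∀ (p q : P.Ob) (a : A.Hom (β.obj p) (β.obj q)) (a'' : A''.Hom (α.obj p) (α.obj q)),
        F.map₁ a ≍ G.map₁ a'' → ∃! h : P.Hom p q, β.map₁ h = a ∧ α.map₁ h = a'') ∧
      -- the unit of `(x, y)` is `(1_x, 1_y)`
      (∀ p : P.Ob, β.map₁ (P.one p) = A.one (β.obj p) ∧ α.map₁ (P.one p) = A''.one (α.obj p)) ∧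
      α.F1 := by
  have s := hF.linSection
  refine ⟨suCat G s, right G s, left G s, isPullback s, ?_, ?_, ?_, ?_⟩
  · intro x y h
    refine ⟨⟨(x, y), h⟩, ⟨rfl, rfl⟩, ?_⟩
    rintro p ⟨rfl, rfl⟩
    rfl
  · intro p q a a'' h
    have e : diff F.toFormalMor G.toFormalMor p q (a, a'') = 0 :=
      sub_eq_zero.2 (eq_of_heq ((ident_heq _).trans h.symm))
    refine ⟨⟨(a, a''), e⟩, ⟨toLeft_lin s _, rfl⟩, ?_⟩
    rintro f ⟨h₁, h₂⟩
    exact Pullback.hom_ext ((toLeft_lin s f).symm.trans h₁) h₂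
  · exact fun p => ⟨toLeft_one s p, rfl⟩
  · intro p q
    -- The section of `α¹` is `a'' ↦ (s (G¹ a''), a'')`; `retract` supplies membership in the
    -- pullback and leaves the second entry alone.
    refine ⟨retract s p q ∘ₗ LinearMap.prod (s.lift _ _ ∘ₗ ident _ _ p q ∘ₗ G.lin _ _)
      LinearMap.id, fun d g hg => ?_, fun g => rfl⟩
    exact retract_mem s (s.lift_mem (ident_mem _ _ (G.lin_mem hg))) hg
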